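/- Let $\alpha>0$ and let $G^2_\alpha$ be the $\alpha$-Grushin plane, i.e. $\mathbb R^2$ with the horizontal vector fields $X=\partial_x$ and $Y_\alpha=|x|^\alpha\partial_y$ (and Lebesgue measure). For open $U\subset\mathbb R^2$ and $p\ge 1$, $HW^{1,p}(U)$ is the space of $u\in L^p(U)$ that have weak first partial derivatives on $U$ with $Xu,\,Y_\alpha u\in L^p(U)$. For open $\Omega,\Omega'$, a map $g=(g_1,g_2):\Omega\to\Omega'$ is in $HW^{1,p}_{\mathrm{loc}}(\Omega,\Omega')$ if $g_1,g_2\in HW^{1,p}(U)$ for every open $U$ with compact closure $\overline U\subset\Omega$. In what follows the partial derivatives are the usual ones, which exist almost everywhere for the maps considered. A map $g\in HW^{1,1}_{\mathrm{loc}}(\Omega,\Omega')$ is *orientation preserving* if $X(g_1)Y_\alpha(g_2)-Y_\alpha(g_1)X(g_2)>0$ a.e. in $\Omega$. A homeomorphism $g\in HW^{1,2}_{\mathrm{loc}}(\Omega,\Omega')$ of $\Omega$ onto $\Omega'$ is *conformal* if, with $S_g=\{(x,y)\in\Omega : x=0 \text{ or } g_1(x,y)=0\}$, $R_g=\Omega\setminus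 S_g$ and $$D_\alpha g=\begin{bmatrix} X(g_1) & Y_\alpha(g_1)\\ X(g_2)/|g_1|^\alpha & Y_\alpha(g_2)/|g_1|^\alpha\end{bmatrix},$$ (i) at almost every point of $R_g$ the matrix $D_\alpha g$ is a positive multiple of an orthogonal matrix, and (ii) for every $z_0\in S_g$ the limit of $D_\alpha g(z)$ as $R_g\ni z\to z_0$ exists, is finite and is not the zero matrix. Let $\mathcal C_\alpha$ denote the class of all orientation preserving conformal maps $g:\Omega\to\Omega'$ between open sets of $G^2_\alpha$ with $g\in HW^{1,2(\alpha+1)/\alpha}_{\mathrm{loc}}(\Omega,\Omega')$. **Corollary (Basic properties of Grushin-conformal mappings).** Let $g:\Omega_g\to\Omega_g'$ and $h:\Omega_h\to\Omega_h'$ belong to $\mathcal C_\alpha$. Then: 1. $g\circ h$ and $h\circ g$ belong to $\mathcal C_\alpha$, where $g\circ h$ is considered as a map from $\{z\in\Omega_h : h(z)\in\Omega_g\}$ onto its image, and similarly for $h\circ g$; 2. $g^{-1}:\Omega_g'\to\Omega_g$ and $h^{-1}:\Omega_h'\to\Omega_h$ belong to $\mathcal C_\alpha$. In particular, for every $\lambda>0$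 and the dilation $\delta_\lambda(x,y)=(\lambda x,\lambda^{\alpha+1}y)$, the maps $g\circ\delta_\lambda:\delta_\lambda^{-1}(\Omega_g)\to\Omega_g'$ and $\delta_\lambda\circ g:\Omega_g\to\delta_\lambda(\Omega_g')$ belong to $\mathcal C_\alpha$; in particular they are conformal. -/

import Mathlib

open MeasureTheory Filter Topology
open scoped ContDiff

/-!
The `α`-Grushin plane is modelled on `ℝ × ℝ` with its usual topology (which is also the topology of
the Carnot–Carathéodory distance) and Lebesgue measure.
-/

namespace Grushin

noncomputable section

/-- `v` is the weak derivative of `u` in the direction `e` on the open set `U`. -/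
def HasWeakDerivOn (U : Set (ℝ × ℝ)) (e : ℝ × ℝ) (u v : ℝ × ℝ → ℝ) : Prop :=
  LocallyIntegrableOn u U ∧ LocallyIntegrableOn v U ∧
    ∀ φ : ℝ × ℝ → ℝ, ContDiff ℝ ∞ φ → HasCompactSupport φ → tsupport φ ⊆ U →
      ∫ p in U, u p * fderiv ℝ φ p e = -∫ p in U, v p * φ p

/-- The horizontal Sobolev space `HW^{1,p}(U)`: `u ∈ L^p(U)` has weak partial derivatives
`∂u/∂x`, `∂u/∂y`, and `(∂u/∂x, |x|^α ∂u/∂y) ∈ L^p(U)`. -/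
def MemHW (α : ℝ) (p : ENNReal) (U : Set (ℝ × ℝ)) (u : ℝ × ℝ → ℝ) : Prop :=
  MemLp u p (volume.restrict U) ∧
    ∃ ux uy : ℝ × ℝ → ℝ,
      HasWeakDerivOn U (1, 0) u ux ∧ HasWeakDerivOn U (0, 1) u uy ∧
      MemLp ux p (volume.restrict U) ∧
      MemLp (fun z => |z.1| ^ α * uy z) p (volume.restrict U)

/-- The horizontal Sobolev space of mappings `HW^{1,p}(U, Ω')`. -/
def MemHWMap (α : ℝ) (p : ENNReal) (U Ω' : Set (ℝ × ℝ)) (f : ℝ × ℝ → ℝ × ℝ) : Prop :=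
  Set.MapsTo f U Ω' ∧ MemHW α p U (fun z => (f z).1) ∧ MemHW α p U (fun z => (f z).2)

/-- The local horizontal Sobolev space of mappings `HW^{1,p}_loc(Ω, Ω')`: membership in
`HW^{1,p}(U, Ω')` for every open `U` whose closure is a compact subset of `Ω`. -/
def MemHWLocMap (α : ℝ) (p : ENNReal) (Ω Ω' : Set (ℝ × ℝ)) (f : ℝ × ℝ → ℝ × ℝ) : Prop :=
  Set.MapsTo f Ω Ω' ∧
    ∀ U : Set (ℝ × ℝ), IsOpen U → IsCompact (closure U) → closure U ⊆ Ω → MemHWMap α p U Ω' f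

/-- `X u = ∂u/∂x`, with the usual (pointwise) partial derivative. -/
def X (u : ℝ × ℝ → ℝ) (z : ℝ × ℝ) : ℝ :=
  deriv (fun t => u (t, z.2)) z.1

/-- `Y_α u = |x|^α ∂u/∂y`, with the usual (pointwise) partial derivative. -/
def Y (α : ℝ) (u : ℝ × ℝ → ℝ) (z : ℝ × ℝ) : ℝ :=
  |z.1| ^ α * deriv (fun t => u (z.1, t)) z.2

/-- The matrix `D_H f`. -/
def DH (α : ℝ) (f : ℝ × ℝ → ℝ × ℝ) (z : ℝ × ℝ) : Matrix (Fin 2) (Fin 2) ℝ :=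
  !![X (fun w => (f w).1) z, Y α (fun w => (f w).1) z;
     X (fun w => (f w).2) z, Y α (fun w => (f w).2) z]

/-- The matrix `D_α f`: the second row of `D_H f` is divided by `|f₁|^α`. -/
def Dα (α : ℝ) (f : ℝ × ℝ → ℝ × ℝ) (z : ℝ × ℝ) : Matrix (Fin 2) (Fin 2) ℝ :=
  !![X (fun w => (f w).1) z, Y α (fun w => (f w).1) z;
     X (fun w => (f w).2) z / |(f z).1| ^ α, Y α (fun w => (f w).2) z / |(f z).1| ^ α]

/-- The singular set `S_f` of `f : Ω → ℝ²`. -/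
def singularSet (Ω : Set (ℝ × ℝ)) (f : ℝ × ℝ → ℝ × ℝ) : Set (ℝ × ℝ) :=
  {z ∈ Ω | z.1 = 0 ∨ (f z).1 = 0}

/-- The regular set `R_f` of `f : Ω → ℝ²`. -/
def regularSet (Ω : Set (ℝ × ℝ)) (f : ℝ × ℝ → ℝ × ℝ) : Set (ℝ × ℝ) :=
  Ω \ singularSet Ω f

/-- A Sobolev map is orientation preserving if `det D_H f > 0` almost everywhere. -/
def OrientationPreserving (α : ℝ) (Ω Ω' : Set (ℝ × ℝ)) (f : ℝ × ℝ → ℝ × ℝ) : Prop :=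
  MemHWLocMap α 1 Ω Ω' f ∧ ∀ᵐ z ∂(volume.restrict Ω), 0 < (DH α f z).det

/-- A homeomorphism `g` between the open sets `g.source` and `g.target` is conformal in the
Grushin plane. -/
def IsConformal (α : ℝ) (g : OpenPartialHomeomorph (ℝ × ℝ) (ℝ × ℝ)) : Prop :=
  MemHWLocMap α 2 g.source g.target g ∧
    (∀ᵐ z ∂(volume.restrict (regularSet g.source g)),
      ∃ c : ℝ, 0 < c ∧ ∃ O ∈ Matrix.orthogonalGroup (Fin 2) ℝ, Dα α g z = c • O) ∧
    ∀ z₀ ∈ singularSet g.source g,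
      ∃ L : Matrix (Fin 2) (Fin 2) ℝ, L ≠ 0 ∧
        Tendsto (Dα α g) (𝓝[regularSet g.source g] z₀) (𝓝 L)

/-- `g` is an orientation preserving conformal map of class `HW^{1, 2(α+1)/α}_loc`. -/
def IsSobolevConformal (α : ℝ) (g : OpenPartialHomeomorph (ℝ × ℝ) (ℝ × ℝ)) : Prop :=
  OrientationPreserving α g.source g.target g ∧ IsConformal α g ∧
    MemHWLocMap α (ENNReal.ofReal (2 * (α + 1) / α)) g.source g.target g

/-- The dilation `δ_r (x, y) = (r x, r^(α+1) y)`, `r > 0`. -/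
def dilation (α r : ℝ) (hr : 0 < r) : (ℝ × ℝ) ≃ₜ (ℝ × ℝ) where
  toFun z := (r * z.1, r ^ (α + 1) * z.2)
  invFun z := (r⁻¹ * z.1, (r ^ (α + 1))⁻¹ * z.2)
  left_inv z := by
    have h : r ^ (α + 1) ≠ 0 := (Real.rpow_pos_of_pos hr _).ne'
    ext <;> simp [hr.ne', h]
  right_inv z := by
    have h : r ^ (α + 1) ≠ 0 := (Real.rpow_pos_of_pos hr _).ne'
    ext <;> simp [hr.ne', h]
  continuous_toFun := by fun_prop
  continuous_invFun := by fun_prop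

end

end Grushin

namespace Grushin

/-! In the coordinate `Phi (x, y) = phi x + i y`, where `phi x = x|x|^α/(α+1)` has derivative
`|x|^α`, Grushin geometry becomes complex analysis. Put `F = Phi ∘ g ∘ Phi⁻¹`. The theorem reduces
to the characterization `isSobolevConformal_iff`: `g` is in the class exactly when `F` is
holomorphic and `g` maps points of the line `x = 0`, and only those, into that line. This second
description is stable under composition and under inversion (an injective holomorphic map has
holomorphic inverse), and `δ_r` becomes multiplication by `r^(α+1)`.

From conformal to holomorphic: condition (i) and the sign of the determinant give the Cauchy–Riemann
equations almost everywhere. The set `g₁ = 0` is harmless, because the partial derivatives of `g₁`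
vanish almost everywhere on it, against the positive determinant. Since the derivatives are only
weak, holomorphy comes from Morera's theorem (`differentiableOn_of_cauchyRiemann`): absolute
continuity on almost every line turns the equations into vanishing integrals around rectangles. Off
the singular set `Dα g` is `|x|^α/|g₁|^α` times the matrix of `F' ≠ 0`; if just one of `x`, `g₁`
vanished at a point, the limit in (ii) would be zero or infinite.

From holomorphic to conformal: only the singular line matters. There `F` preserves the imaginary
axis, so `Re F / Re w` tends to the nonzero real number `F'`. Hence `|x|^α/|g₁|^α` extends to a
continuous positive function, and `Im F' = O(|x|^(α+1))`. So `g` has continuous partial derivatives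
and lies in every local Sobolev class. -/

/-! ### Smooth cut-offs and the one-dimensional fundamental theorem -/

lemma deriv_smoothTransition_support :
    Function.support (deriv Real.smoothTransition) ⊆ Set.Ioc 0 1 := by
  intro s hs
  by_contra hcon
  apply hs
  rcases le_or_gt s 0 with h0 | h0
  -- The value 0 is a global minimum; this covers `s = 0` too, so the support lies in the half-open
  -- interval used by interval integrals.
  · apply IsLocalMin.deriv_eq_zero
    refine Eventually.of_forall fun x => ?_
    rw [Real.smoothTransition.zero_of_nonpos h0]
    exact Real.smoothTransition.nonneg x
  · have h1 : 1 < s := by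
      by_contra h
      exact hcon ⟨h0, not_lt.1 h⟩
    have : Real.smoothTransition =ᶠ[𝓝 s] fun _ => (1 : ℝ) := by
      filter_upwards [lt_mem_nhds h1] with x hx
      exact Real.smoothTransition.one_of_one_le hx.le
    rw [this.deriv_eq]
    simp

lemma continuous_deriv_smoothTransition : Continuous (deriv Real.smoothTransition) :=
  (Real.smoothTransition.contDiff (n := 1)).continuous_deriv le_rfl

/-- The derivatives of steep smooth steps at `p` converge to the Dirac mass at `p`. -/
lemma tendsto_integral_mul_deriv_step {w : ℝ → ℝ} (hw : Continuous w) (p : ℝ) :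
    Tendsto (fun n : ℕ => ∫ x, w x *
      (((n : ℝ) + 1) * deriv Real.smoothTransition (((n : ℝ) + 1) * (x - p))))
      atTop (𝓝 (w p)) := by
  -- The substitution `s = N (x - p)` turns the integral into `G (1/N)`; `G` is continuous and `G 0
  -- = w p`.
  set G : ℝ → ℝ := fun ε => ∫ s in (0 : ℝ)..1, w (p + s * ε) * deriv Real.smoothTransition s
    with hG
  have hGc : Continuous G := by
    apply intervalIntegral.continuous_parametric_intervalIntegral_of_continuous'
    have := continuous_deriv_smoothTransition
    fun_prop
  have hG0 : G 0 = w p := by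
    simp only [hG, mul_zero, add_zero]
    rw [intervalIntegral.integral_const_mul, intervalIntegral.integral_deriv_eq_sub]
    · simp
    · intro x _
      exact ((Real.smoothTransition.contDiff (n := 1)).differentiable (by simp)) x
    · exact continuous_deriv_smoothTransition.intervalIntegrable _ _
  have hlim : Tendsto (fun n : ℕ => G (1 / ((n : ℝ) + 1))) atTop (𝓝 (w p)) := by
    rw [← hG0]
    exact (hGc.tendsto 0).comp tendsto_one_div_add_atTop_nhds_zero_nat
  refine hlim.congr fun n => ?_
  have hN : (0 : ℝ) < (n : ℝ) + 1 := by positivity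
  set N : ℝ := (n : ℝ) + 1
  set m : ℝ → ℝ := fun s => w (p + s * (1 / N)) * (N * deriv Real.smoothTransition s) with hm
  have h1 : ∀ x, w x * (N * deriv Real.smoothTransition (N * (x - p))) = m (N * (x - p)) := by
    intro x
    have : p + N * (x - p) * (1 / N) = x := by field_simp; ring
    simp only [hm, this]
  rw [integral_congr_ae (Eventually.of_forall h1),
    integral_sub_right_eq_self (fun t => m (N * t)) p,
    Measure.integral_comp_mul_left, abs_of_pos (inv_pos.2 hN)]
  simp only [hG]
  rw [intervalIntegral.integral_eq_integral_of_support_subset, smul_eq_mul, ← integral_const_mul]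
  · congr 1
    ext s
    simp only [hm]
    field_simp
  · exact (Function.support_mul_subset_right _ _).trans deriv_smoothTransition_support

/-- A smooth cut-off function of `(p, q]` of steepness `N`. -/
noncomputable def cutoff (p q N : ℝ) (x : ℝ) : ℝ :=
  Real.smoothTransition (N * (x - p)) - Real.smoothTransition (N * (x - q))

lemma contDiff_cutoff (p q N : ℝ) : ContDiff ℝ ∞ (cutoff p q N) := by
  have h : ContDiff ℝ ∞ Real.smoothTransition := Real.smoothTransition.contDiff (n := ⊤)
  unfold cutoff
  exact (h.comp (by fun_prop)).sub (h.comp (by fun_prop))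

lemma deriv_cutoff (p q N x : ℝ) : deriv (cutoff p q N) x =
    N * deriv Real.smoothTransition (N * (x - p)) -
      N * deriv Real.smoothTransition (N * (x - q)) := by
  have hd : Differentiable ℝ Real.smoothTransition :=
    (Real.smoothTransition.contDiff (n := 1)).differentiable (by simp)
  have h (r : ℝ) : HasDerivAt (fun x => Real.smoothTransition (N * (x - r)))
      (N * deriv Real.smoothTransition (N * (x - r))) x := by
    have h2 : HasDerivAt (fun x => N * (x - r)) N x := by
      simpa using ((hasDerivAt_id x).sub_const r).const_mul N
    have h3 := (hd (N * (x - r))).hasDerivAt.comp x h2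
    rwa [mul_comm] at h3
  exact ((h p).sub (h q)).deriv

lemma abs_cutoff_le (p q N x : ℝ) : |cutoff p q N x| ≤ 1 := by
  have h1 := Real.smoothTransition.nonneg (N * (x - p))
  have h2 := Real.smoothTransition.nonneg (N * (x - q))
  have h3 := Real.smoothTransition.le_one (N * (x - p))
  have h4 := Real.smoothTransition.le_one (N * (x - q))
  rw [abs_le, cutoff]
  constructor <;> linarith

lemma cutoff_eq_zero {p q N x : ℝ} (hN : 0 < N) (hpq : p ≤ q) (hx : x ∉ Set.Icc p (q + 1 / N)) :
    cutoff p q N x = 0 := by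
  rw [cutoff]
  rcases lt_or_ge x p with h | h
  · rw [Real.smoothTransition.zero_of_nonpos, Real.smoothTransition.zero_of_nonpos, sub_zero]
    · exact mul_nonpos_of_nonneg_of_nonpos hN.le (by linarith)
    · exact mul_nonpos_of_nonneg_of_nonpos hN.le (by linarith)
  · have h2 : q + 1 / N < x := by
      by_contra h3
      exact hx ⟨h, not_lt.1 h3⟩
    have h3 : 1 ≤ N * (x - q) := by
      have : N * (1 / N) ≤ N * (x - q) := by gcongr; linarith
      rwa [mul_one_div_cancel hN.ne'] at this
    rw [Real.smoothTransition.one_of_one_le h3, Real.smoothTransition.one_of_one_le, sub_self]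
    refine h3.trans ?_
    gcongr

lemma tsupport_cutoff_subset {p q N : ℝ} (hN : 0 < N) (hpq : p ≤ q) :
    tsupport (cutoff p q N) ⊆ Set.Icc p (q + 1 / N) := by
  apply closure_minimal _ isClosed_Icc
  intro x hx
  by_contra h
  exact hx (cutoff_eq_zero hN hpq h)

lemma tendsto_cutoff {p q : ℝ} (x : ℝ) :
    Tendsto (fun n : ℕ => cutoff p q ((n : ℝ) + 1) x) atTop
      (𝓝 ((Set.Ioi p).indicator 1 x - (Set.Ioi q).indicator 1 x)) := by
  have h (r : ℝ) : Tendsto (fun n : ℕ => Real.smoothTransition (((n : ℝ) + 1) * (x - r))) atTop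
      (𝓝 ((Set.Ioi r).indicator 1 x)) := by
    by_cases hx : r < x
    · rw [Set.indicator_of_mem (by exact hx)]
      apply tendsto_const_nhds.congr'
      obtain ⟨m, hm⟩ := exists_nat_gt (1 / (x - r))
      filter_upwards [eventually_ge_atTop m] with n hn
      have hpos : 0 < x - r := by linarith
      rw [Real.smoothTransition.one_of_one_le]
      · rfl
      have : (m : ℝ) ≤ n := by exact_mod_cast hn
      rw [div_lt_iff₀ hpos] at hm
      nlinarith
    · rw [Set.indicator_of_notMem (by exact hx)]
      apply tendsto_const_nhds.congr'
      refine Eventually.of_forall fun n => (Real.smoothTransition.zero_of_nonpos ?_).symm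
      exact mul_nonpos_of_nonneg_of_nonpos (by positivity) (by linarith)
  exact (h p).sub (h q)

lemma tendsto_integral_mul_deriv_cutoff {w : ℝ → ℝ} (hw : Continuous w) (p q : ℝ) :
    Tendsto (fun n : ℕ => ∫ x, w x * deriv (cutoff p q ((n : ℝ) + 1)) x)
      atTop (𝓝 (w p - w q)) := by
  refine ((tendsto_integral_mul_deriv_step hw p).sub
    (tendsto_integral_mul_deriv_step hw q)).congr fun n => ?_
  have hi (r : ℝ) : Integrable fun x => w x *
      (((n : ℝ) + 1) * deriv Real.smoothTransition (((n : ℝ) + 1) * (x - r))) := by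
    apply Continuous.integrable_of_hasCompactSupport
    · have := continuous_deriv_smoothTransition
      fun_prop
    · have hN : (0 : ℝ) < (n : ℝ) + 1 := by positivity
      apply HasCompactSupport.intro (K := Set.Icc r (r + 1 / ((n : ℝ) + 1))) isCompact_Icc
      intro x hx
      have : deriv Real.smoothTransition (((n : ℝ) + 1) * (x - r)) = 0 := by
        by_contra h
        obtain ⟨h1, h2⟩ := deriv_smoothTransition_support h
        apply hx
        constructor
        · have := pos_of_mul_pos_right h1 hN.le
          linarith
        · have : x - r ≤ 1 / ((n : ℝ) + 1) := by
            rw [le_div_iff₀ hN]; linarith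
          linarith
      simp [this]
  rw [← integral_sub (hi p) (hi q)]
  congr 1
  ext x
  rw [deriv_cutoff]
  ring

/-- If `w` is continuous with weak derivative `v` tested against the cut-offs of `(p, q]`, then
`w q - w p` is the integral of `v`. -/
lemma sub_eq_integral_of_cutoff {w v : ℝ → ℝ} (hw : Continuous w) {a b p q : ℝ}
    (hv : IntegrableOn v (Set.Ioo a b)) (hap : a < p) (hpq : p ≤ q) (hqb : q < b)
    (h : ∀ n : ℕ, q + 1 / ((n : ℝ) + 1) < b →
      ∫ x in Set.Ioo a b, (w x * deriv (cutoff p q ((n : ℝ) + 1)) x +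
        v x * cutoff p q ((n : ℝ) + 1) x) = 0) :
    w q - w p = ∫ x in p..q, v x := by
  have hc (n : ℕ) : Continuous (deriv (cutoff p q ((n : ℝ) + 1))) :=
    (contDiff_cutoff p q _).continuous_deriv (by simp)
  have hev : ∀ᶠ n : ℕ in atTop, q + 1 / ((n : ℝ) + 1) < b := by
    have := (tendsto_one_div_add_atTop_nhds_zero_nat (𝕜 := ℝ)).const_add q
    rw [add_zero] at this
    exact this.eventually_lt_const hqb
  -- As the steepness grows, the derivative of the cut-off tends to `δ_p - δ_q` and the cut-off
  -- itself to the indicator of `(p, q]`.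
  have h1 : Tendsto (fun n : ℕ => ∫ x in Set.Ioo a b, w x * deriv (cutoff p q ((n : ℝ) + 1)) x)
      atTop (𝓝 (w p - w q)) := by
    refine (tendsto_integral_mul_deriv_cutoff hw p q).congr' ?_
    filter_upwards [hev] with n hn
    rw [setIntegral_eq_integral_of_forall_compl_eq_zero]
    intro x hx
    have : deriv (cutoff p q ((n : ℝ) + 1)) x = 0 := by
      by_contra h0
      apply hx
      have := tsupport_cutoff_subset (by positivity) hpq
        (support_deriv_subset (Function.mem_support.2 h0))
      exact ⟨by linarith [this.1], by linarith [this.2]⟩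
    simp [this]
  have h2 : Tendsto (fun n : ℕ => ∫ x in Set.Ioo a b, v x * cutoff p q ((n : ℝ) + 1) x)
      atTop (𝓝 (∫ x in Set.Ioo a b,
        v x * ((Set.Ioi p).indicator 1 x - (Set.Ioi q).indicator 1 x))) := by
    apply tendsto_integral_of_dominated_convergence (fun x => |v x|)
    · intro n
      exact hv.aestronglyMeasurable.mul (contDiff_cutoff p q _).continuous.aestronglyMeasurable
    · exact hv.abs
    · intro n
      refine Eventually.of_forall fun x => ?_
      rw [Real.norm_eq_abs, abs_mul]
      exact mul_le_of_le_one_right (abs_nonneg _) (abs_cutoff_le _ _ _ _)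
    · exact Eventually.of_forall fun x => (tendsto_cutoff x).const_mul _
  have h3 : ∫ x in Set.Ioo a b, v x * ((Set.Ioi p).indicator 1 x - (Set.Ioi q).indicator 1 x) =
      ∫ x in p..q, v x := by
    rw [intervalIntegral.integral_of_le hpq, ← integral_indicator measurableSet_Ioo,
      ← integral_indicator measurableSet_Ioc]
    congr 1
    ext x
    simp only [Set.indicator_apply, Set.mem_Ioo, Set.mem_Ioi, Set.mem_Ioc, Pi.one_apply]
    split_ifs <;> grind
  rw [h3] at h2
  have h4 := h1.add h2
  have h5 : (fun n : ℕ => ∫ x in Set.Ioo a b, w x * deriv (cutoff p q ((n : ℝ) + 1)) x) +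
      (fun n : ℕ => ∫ x in Set.Ioo a b, v x * cutoff p q ((n : ℝ) + 1) x) =ᶠ[atTop] fun _ => 0 := by
    filter_upwards [hev] with n hn
    rw [Pi.add_apply, ← h n hn, integral_add]
    · exact ((hw.mul (hc n)).integrableOn_Icc (a := a) (b := b)).mono_set Set.Ioo_subset_Icc_self
    · exact hv.mul_bdd (c := 1) (contDiff_cutoff p q _).continuous.aestronglyMeasurable
        (Eventually.of_forall fun x => abs_cutoff_le _ _ _ _)
  have h6 := tendsto_nhds_unique (h4.congr' h5) tendsto_const_nhds
  linarith

/-! ### Weak derivatives on rectangles and absolute continuity on lines -/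

lemma volume_restrict_prod (s t : Set ℝ) :
    (volume : Measure (ℝ × ℝ)).restrict (s ×ˢ t) =
      (volume.restrict s).prod (volume.restrict t) := by
  rw [Measure.prod_restrict, ← Measure.volume_eq_prod]

lemma HasWeakDerivOn.congr {U : Set (ℝ × ℝ)} (hU : MeasurableSet U) {e : ℝ × ℝ}
    {u u' v : ℝ × ℝ → ℝ} (h : HasWeakDerivOn U e u v) (huu' : Set.EqOn u u' U) :
    HasWeakDerivOn U e u' v := by
  refine ⟨?_, h.2.1, fun φ h1 h2 h3 => ?_⟩
  · intro x hx
    obtain ⟨s, hs, hus⟩ := h.1 x hx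
    refine ⟨s ∩ U, inter_mem hs self_mem_nhdsWithin, ?_⟩
    refine (hus.mono_set Set.inter_subset_left).congr ?_
    exact ae_restrict_of_ae_restrict_of_subset Set.inter_subset_right
      ((ae_restrict_iff' hU).2 (Eventually.of_forall huu'))
  · rw [← h.2.2 φ h1 h2 h3]
    exact setIntegral_congr_fun hU fun z hz => by simp only [huu' hz]

lemma HasWeakDerivOn.mono {U V : Set (ℝ × ℝ)} {e : ℝ × ℝ}
    {u v : ℝ × ℝ → ℝ} (h : HasWeakDerivOn U e u v) (hVU : V ⊆ U) :
    HasWeakDerivOn V e u v := by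
  refine ⟨h.1.mono_set hVU, h.2.1.mono_set hVU, fun φ h1 h2 h3 => ?_⟩
  have := h.2.2 φ h1 h2 (h3.trans hVU)
  have key (W : Set (ℝ × ℝ)) (hW : tsupport φ ⊆ W) :
      ∫ p in W, u p * fderiv ℝ φ p e = ∫ p, u p * fderiv ℝ φ p e ∧
      ∫ p in W, v p * φ p = ∫ p, v p * φ p := by
    constructor
    · apply setIntegral_eq_integral_of_forall_compl_eq_zero
      intro z hz
      have : fderiv ℝ φ z = 0 := by
        by_contra h0
        exact hz (hW (support_fderiv_subset ℝ h0))
      simp [this]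
    · apply setIntegral_eq_integral_of_forall_compl_eq_zero
      intro z hz
      rw [image_eq_zero_of_notMem_tsupport fun h0 => hz (hW h0), mul_zero]
  rw [(key V h3).1, (key V h3).2, ← (key U (h3.trans hVU)).1, ← (key U (h3.trans hVU)).2]
  exact this

/-- Testing a weak `x`-derivative against products yields the one-dimensional weak derivative on
almost every horizontal line. -/
lemma HasWeakDerivOn.ae_integral_eq_zero {a b c d : ℝ} {u v : ℝ × ℝ → ℝ} (hu : Continuous u)
    (h : HasWeakDerivOn (Set.Ioo a b ×ˢ Set.Ioo c d) (1, 0) u v)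
    (hv : IntegrableOn v (Set.Ioo a b ×ˢ Set.Ioo c d)) {A : ℝ → ℝ} (hA : ContDiff ℝ ∞ A)
    (hAs : tsupport A ⊆ Set.Ioo a b) :
    ∀ᵐ y, y ∈ Set.Ioo c d →
      ∫ x in Set.Ioo a b, (u (x, y) * deriv A x + v (x, y) * A x) = 0 := by
  have hAc : HasCompactSupport A :=
    isCompact_Icc.of_isClosed_subset (isClosed_tsupport A) (hAs.trans Set.Ioo_subset_Icc_self)
  have hA' : Continuous (deriv A) := hA.continuous_deriv (by simp)
  obtain ⟨CA, hCA⟩ := hA.continuous.bounded_above_of_compact_support hAc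
  have hi1 (w : ℝ × ℝ → ℝ) (hw : Continuous w) :
      IntegrableOn w (Set.Ioo a b ×ˢ Set.Ioo c d) := by
    have hcpt : IsCompact (Set.Icc a b ×ˢ Set.Icc c d) := isCompact_Icc.prod isCompact_Icc
    exact (hw.continuousOn.integrableOn_compact hcpt).mono_set
      (Set.prod_mono Set.Ioo_subset_Icc_self Set.Ioo_subset_Icc_self)
  have hi2 : IntegrableOn (fun z : ℝ × ℝ => v z * A z.1) (Set.Ioo a b ×ˢ Set.Ioo c d) :=
    hv.mul_bdd (c := CA) (hA.continuous.comp continuous_fst).aestronglyMeasurable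
      (Eventually.of_forall fun z => hCA _)
  have hK : Integrable (fun z : ℝ × ℝ => u z * deriv A z.1 + v z * A z.1)
      ((volume.restrict (Set.Ioo a b)).prod (volume.restrict (Set.Ioo c d))) := by
    rw [← volume_restrict_prod]
    exact (hi1 _ (by fun_prop)).add hi2
  -- A function of `y` vanishes almost everywhere once it integrates to zero against every smooth
  -- `B`; Fubini recasts this as the weak derivative tested on `A(x) B(y)`.
  apply isOpen_Ioo.ae_eq_zero_of_integral_contDiff_smul_eq_zero
  · exact IntegrableOn.locallyIntegrableOn hK.integral_prod_right
  intro B hB hBc hBs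
  obtain ⟨CB, hCB⟩ := hB.continuous.bounded_above_of_compact_support hBc
  have hzero : ∀ y, y ∉ Set.Ioo c d → B y = 0 := fun y hy =>
    image_eq_zero_of_notMem_tsupport fun h0 => hy (hBs h0)
  rw [← setIntegral_eq_integral_of_forall_compl_eq_zero (s := Set.Ioo c d)
    (fun y hy => by simp [hzero y hy])]
  simp_rw [smul_eq_mul, ← integral_const_mul]
  set φ : ℝ × ℝ → ℝ := fun z => A z.1 * B z.2 with hφ
  have hφs : tsupport φ ⊆ tsupport A ×ˢ tsupport B := by
    apply closure_minimal _ ((isClosed_tsupport A).prod (isClosed_tsupport B))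
    intro z hz
    exact ⟨subset_tsupport _ (left_ne_zero_of_mul hz), subset_tsupport _ (right_ne_zero_of_mul hz)⟩
  have hφ' (z : ℝ × ℝ) : fderiv ℝ φ z (1, 0) = deriv A z.1 * B z.2 := by
    have h1 : HasFDerivAt (fun z : ℝ × ℝ => A z.1) _ z :=
      ((hA.differentiable (by simp)) z.1).hasDerivAt.comp_hasFDerivAt z (hasFDerivAt_fst (𝕜 := ℝ))
    have h2 : HasFDerivAt (fun z : ℝ × ℝ => B z.2) _ z :=
      ((hB.differentiable (by simp)) z.2).hasDerivAt.comp_hasFDerivAt z (hasFDerivAt_snd (𝕜 := ℝ))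
    have h3 : HasFDerivAt φ _ z := h1.mul h2
    rw [h3.fderiv]
    simp [mul_comm]
  have hweak := h.2.2 φ ((hA.comp contDiff_fst).mul (hB.comp contDiff_snd))
    ((hAc.isCompact.prod hBc.isCompact).of_isClosed_subset (isClosed_tsupport φ) hφs)
    (hφs.trans (Set.prod_mono hAs hBs))
  simp_rw [hφ'] at hweak
  have hi3 : IntegrableOn (fun z : ℝ × ℝ => v z * φ z) (Set.Ioo a b ×ˢ Set.Ioo c d) := by
    have := hi2.mul_bdd (c := CB) (hB.continuous.comp continuous_snd).aestronglyMeasurable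
      (Eventually.of_forall fun z : ℝ × ℝ => hCB z.2)
    refine this.congr (Eventually.of_forall fun z => ?_)
    simp only [hφ, Function.comp]
    ring
  have hB' := hB.continuous
  have hi4 : IntegrableOn (fun z : ℝ × ℝ => u z * (deriv A z.1 * B z.2))
      (Set.Ioo a b ×ˢ Set.Ioo c d) := hi1 _ (by fun_prop)
  have hi5 : Integrable (fun z : ℝ × ℝ => B z.2 * (u z * deriv A z.1 + v z * A z.1))
      ((volume.restrict (Set.Ioo a b)).prod (volume.restrict (Set.Ioo c d))) := by
    rw [← volume_restrict_prod]
    refine (hi4.add hi3).congr (Eventually.of_forall fun z => ?_)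
    simp only [hφ, Pi.add_apply]
    ring
  rw [← integral_prod_symm _ hi5, ← volume_restrict_prod]
  rw [← sub_eq_zero, sub_neg_eq_add, ← integral_add hi4 hi3] at hweak
  rw [← hweak]
  congr 1
  ext z
  simp only [hφ]
  ring

/-- A continuous function with integrable weak `x`-derivative is a primitive of it on almost every
horizontal line. -/
theorem HasWeakDerivOn.ae_sub_eq_integral {a b c d : ℝ} (hab : a < b) {u v : ℝ × ℝ → ℝ}
    (hu : Continuous u) (h : HasWeakDerivOn (Set.Ioo a b ×ˢ Set.Ioo c d) (1, 0) u v)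
    (hv : IntegrableOn v (Set.Ioo a b ×ˢ Set.Ioo c d)) :
    ∀ᵐ y, y ∈ Set.Ioo c d → IntervalIntegrable (fun x => v (x, y)) volume a b ∧
      ∀ x ∈ Set.Icc a b, u (x, y) - u (a, y) = ∫ t in a..x, v (t, y) := by
  have hint : ∀ᵐ y, y ∈ Set.Ioo c d → IntegrableOn (fun x => v (x, y)) (Set.Ioo a b) := by
    rw [IntegrableOn, volume_restrict_prod] at hv
    exact (ae_restrict_iff' measurableSet_Ioo).1 hv.prod_left_ae
  -- The exceptional null set of lines depends on the test function, so only countably many cut-offs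
  -- are used; continuity later passes from rational to real endpoints.
  have hall : ∀ᵐ y, ∀ p q : ℚ, ∀ n : ℕ, a < p → (p : ℝ) ≤ q → (q : ℝ) + 1 / ((n : ℝ) + 1) < b →
      y ∈ Set.Ioo c d → ∫ x in Set.Ioo a b, (u (x, y) * deriv (cutoff p q ((n : ℝ) + 1)) x +
        v (x, y) * cutoff p q ((n : ℝ) + 1) x) = 0 := by
    simp only [ae_all_iff]
    intro p q n h1 h2 h3
    refine h.ae_integral_eq_zero hu hv (contDiff_cutoff _ _ _) ?_
    refine (tsupport_cutoff_subset (by positivity) h2).trans fun x hx => ?_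
    exact ⟨by linarith [hx.1], by linarith [hx.2]⟩
  filter_upwards [hint, hall] with y hy1 hy2 hyJ
  specialize hy1 hyJ
  have hii : IntervalIntegrable (fun x => v (x, y)) volume a b := by
    rw [intervalIntegrable_iff_integrableOn_Ioo_of_le hab.le]
    exact hy1
  refine ⟨hii, ?_⟩
  have huy : Continuous fun x => u (x, y) := by fun_prop
  have hrat (p q : ℚ) (h1 : a < p) (h2 : (p : ℝ) ≤ q) (h3 : (q : ℝ) < b) :
      u (q, y) - u (p, y) = ∫ x in p..q, v (x, y) := by
    refine sub_eq_integral_of_cutoff huy hy1 h1 h2 h3 fun n hn => hy2 p q n h1 h2 hn hyJ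
  set V : ℝ → ℝ := fun x => ∫ t in a..x, v (t, y) with hV
  have hVc : ContinuousOn V (Set.Icc a b) := by
    have := intervalIntegral.continuousOn_primitive_interval (μ := volume)
      (f := fun x => v (x, y)) (a := a) (b := b) ?_
    · rwa [Set.uIcc_of_le hab.le] at this
    · rw [Set.uIcc_of_le hab.le, integrableOn_Icc_iff_integrableOn_Ioo]
      exact hy1
  have hdc : ContinuousOn (fun x => u (x, y) - V x) (Set.Icc a b) := huy.continuousOn.sub hVc
  have hsub (p q : ℝ) (hp : p ∈ Set.Icc a b) (hq : q ∈ Set.Icc a b) :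
      V q - V p = ∫ t in p..q, v (t, y) := by
    have hmem : ∀ r ∈ Set.Icc a b, IntervalIntegrable (fun x => v (x, y)) volume a r :=
      fun r hr => hii.mono_set (by
        rw [Set.uIcc_of_le hr.1, Set.uIcc_of_le hab.le]
        exact Set.Icc_subset_Icc_right hr.2)
    exact intervalIntegral.integral_interval_sub_left (hmem q hq) (hmem p hp)
  obtain ⟨r, hr1, hr2⟩ := exists_rat_btwn hab
  have hconst : ∀ x ∈ Set.Icc a b, u (x, y) - V x = u (r, y) - V r := by
    have hcl : Set.Icc a b ⊆ closure (Set.Ioo a b ∩ Set.range ((↑) : ℚ → ℝ)) := by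
      rw [← closure_Ioo hab.ne]
      apply closure_minimal _ isClosed_closure
      exact Rat.isDenseEmbedding_coe_real.dense.open_subset_closure_inter isOpen_Ioo
    have hcl' : Set.Ioo a b ∩ Set.range ((↑) : ℚ → ℝ) ⊆ Set.Icc a b :=
      Set.inter_subset_left.trans Set.Ioo_subset_Icc_self
    intro x hx
    have : Set.EqOn (fun x => u (x, y) - V x) (fun _ => u (r, y) - V r) (Set.Icc a b) := by
      refine Set.EqOn.of_subset_closure (s := Set.Ioo a b ∩ Set.range ((↑) : ℚ → ℝ)) ?_ hdc
        continuousOn_const hcl' hcl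
      rintro _ ⟨hs, s, rfl⟩
      have hsI := Set.Ioo_subset_Icc_self hs
      have hrI : (r : ℝ) ∈ Set.Icc a b := ⟨hr1.le, hr2.le⟩
      rcases le_total (r : ℝ) s with hle | hle
      · have h1 := hrat r s hr1 hle hs.2
        rw [← hsub _ _ hrI hsI] at h1
        simp only
        linarith
      · have h1 := hrat s r hs.1 hle hr2
        rw [← hsub _ _ hsI hrI] at h1
        simp only
        linarith
    exact this hx
  intro x hx
  have h1 := hconst x hx
  have h2 := hconst a ⟨le_rfl, hab.le⟩
  have h3 : V a = 0 := by simp [hV]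
  rw [h3] at h2
  change _ = V x
  linarith

lemma measurable_X {u : ℝ × ℝ → ℝ} (hu : Continuous u) : Measurable (X u) := by
  have : Continuous (Function.uncurry fun y t : ℝ => u (t, y)) := by
    unfold Function.uncurry
    fun_prop
  exact (measurable_deriv_with_param this).comp measurable_swap

/-- The pointwise partial derivative in the second variable. -/
noncomputable def partialY (u : ℝ × ℝ → ℝ) (z : ℝ × ℝ) : ℝ :=
  deriv (fun t => u (z.1, t)) z.2

lemma Y_eq (α : ℝ) (u : ℝ × ℝ → ℝ) (z : ℝ × ℝ) : Y α u z = |z.1| ^ α * partialY u z := rfl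

lemma absolutelyContinuousOnInterval_comp {f ψ : ℝ → ℝ} {a b : ℝ}
    (hf : AbsolutelyContinuousOnInterval f a b) (hψ : ContDiff ℝ 1 ψ) :
    AbsolutelyContinuousOnInterval (fun x => ψ (f x)) a b := by
  obtain ⟨C, hC⟩ := hf.exists_bound
  obtain ⟨K, hK⟩ := hψ.contDiffOn.exists_lipschitzOnWith (s := Set.Icc (-C) C) (by decide)
    (convex_Icc _ _) isCompact_Icc
  have hmem : ∀ x ∈ Set.uIcc a b, f x ∈ Set.Icc (-C) C := fun x hx => abs_le.1 (hC x hx)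
  rw [absolutelyContinuousOnInterval_iff] at hf ⊢
  intro ε hε
  obtain ⟨δ, hδ, h⟩ := hf (ε / (K + 1)) (by positivity)
  refine ⟨δ, hδ, fun E hE hlen => ?_⟩
  have h1 := h E hE hlen
  have hE' := hE.1
  calc ∑ i ∈ Finset.range E.1, dist (ψ (f (E.2 i).1)) (ψ (f (E.2 i).2))
      ≤ ∑ i ∈ Finset.range E.1, (K + 1) * dist (f (E.2 i).1) (f (E.2 i).2) := by
        apply Finset.sum_le_sum
        intro i hi
        refine (hK.dist_le_mul _ (hmem _ (hE' i hi).1) _ (hmem _ (hE' i hi).2)).trans ?_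
        gcongr
        linarith
    _ = (K + 1) * ∑ i ∈ Finset.range E.1, dist (f (E.2 i).1) (f (E.2 i).2) := by
        rw [Finset.mul_sum]
    _ < (K + 1) * (ε / (K + 1)) := by gcongr
    _ = ε := by field_simp

lemma HasWeakDerivOn.ae_absolutelyContinuousOnInterval {a b c d : ℝ} (hab : a < b)
    {u v : ℝ × ℝ → ℝ} (hu : Continuous u)
    (h : HasWeakDerivOn (Set.Ioo a b ×ˢ Set.Ioo c d) (1, 0) u v)
    (hv : IntegrableOn v (Set.Ioo a b ×ˢ Set.Ioo c d)) :
    ∀ᵐ y, y ∈ Set.Ioo c d → AbsolutelyContinuousOnInterval (fun x => u (x, y)) a b := by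
  filter_upwards [h.ae_sub_eq_integral hab hu hv] with y hy hyJ
  obtain ⟨h1, h2⟩ := hy hyJ
  have h3 := h1.absolutelyContinuousOnInterval_intervalIntegral (c := a) (by simp)
  have h4 : AbsolutelyContinuousOnInterval (fun _ : ℝ => u (a, y)) a b :=
    contDiffOn_const.absolutelyContinuousOnInterval
  have h5 := h3.add h4
  rw [absolutelyContinuousOnInterval_iff] at h5 ⊢
  intro ε hε
  obtain ⟨δ, hδ, h6⟩ := h5 ε hε
  refine ⟨δ, hδ, fun E hE hlen => ?_⟩
  convert h6 E hE hlen using 3 with i hi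
  · have := h2 (E.2 i).1 (by simpa [Set.uIcc_of_le hab.le] using (hE.1 i hi).1)
    simp only [Pi.add_apply]
    linarith
  · have := h2 (E.2 i).2 (by simpa [Set.uIcc_of_le hab.le] using (hE.1 i hi).2)
    simp only [Pi.add_apply]
    linarith

/-- On almost every line `u` is a primitive of `v`, so Lebesgue differentiation applies. The
measurable representative `v'` is needed to exchange the two almost-everywhere quantifiers. -/
lemma HasWeakDerivOn.X_ae_eq {a b c d : ℝ} (hab : a < b)
    {u v : ℝ × ℝ → ℝ} (hu : Continuous u)
    (h : HasWeakDerivOn (Set.Ioo a b ×ˢ Set.Ioo c d) (1, 0) u v)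
    (hv : IntegrableOn v (Set.Ioo a b ×ˢ Set.Ioo c d)) :
    X u =ᵐ[volume.restrict (Set.Ioo a b ×ˢ Set.Ioo c d)] v := by
  have hvm := hv.aestronglyMeasurable
  set v' := hvm.mk v with hv'
  have hvv' : v =ᵐ[volume.restrict (Set.Ioo a b ×ˢ Set.Ioo c d)] v' := hvm.ae_eq_mk
  have hmeas : MeasurableSet {z : ℝ × ℝ | X u z = v' z} :=
    measurableSet_eq_fun (measurable_X hu) hvm.stronglyMeasurable_mk.measurable
  suffices hX : X u =ᵐ[volume.restrict (Set.Ioo a b ×ˢ Set.Ioo c d)] v' from hX.trans hvv'.symm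
  rw [volume_restrict_prod] at hvv' ⊢
  change ∀ᵐ z ∂_, X u z = v' z
  rw [Measure.ae_prod_iff_ae_ae hmeas,
    Measure.ae_ae_comm (p := fun x y => X u (x, y) = v' (x, y)) hmeas]
  have hvv2 : ∀ᵐ y ∂(volume.restrict (Set.Ioo c d)), ∀ᵐ x ∂(volume.restrict (Set.Ioo a b)),
      v (x, y) = v' (x, y) := by
    have h1 := Measure.ae_ae_of_ae_prod ((Measure.measurePreserving_swap
      (μ := volume.restrict (Set.Ioo c d)) (ν := volume.restrict (Set.Ioo a b))
      ).quasiMeasurePreserving.ae hvv')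
    exact h1
  filter_upwards [hvv2, ae_restrict_of_ae (h.ae_sub_eq_integral hab hu hv),
    ae_restrict_mem measurableSet_Ioo] with y hy1 hy2 hyJ
  obtain ⟨h1, h2⟩ := hy2 hyJ
  filter_upwards [hy1, ae_restrict_of_ae h1.ae_hasDerivAt_integral,
    ae_restrict_mem measurableSet_Ioo] with x hx1 hx2 hxI
  rw [← hx1]
  have h3 := hx2 (by rw [Set.uIcc_of_le hab.le]; exact Set.Ioo_subset_Icc_self hxI) a (by simp)
  have h4 : (fun t => u (t, y)) =ᶠ[𝓝 x] fun t => (∫ s in a..t, v (s, y)) + u (a, y) := by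
    filter_upwards [isOpen_Ioo.mem_nhds hxI] with t ht
    rw [← h2 t (Set.Ioo_subset_Icc_self ht)]
    ring
  exact ((h3.add_const (u (a, y))).congr_of_eventuallyEq h4).deriv

lemma HasWeakDerivOn.integrableOn_mul_X {a b c d : ℝ} (hab : a < b)
    {u v : ℝ × ℝ → ℝ} (hu : Continuous u)
    (h : HasWeakDerivOn (Set.Ioo a b ×ˢ Set.Ioo c d) (1, 0) u v)
    (hv : IntegrableOn v (Set.Ioo a b ×ˢ Set.Ioo c d)) {k : ℝ × ℝ → ℝ} (hk : Continuous k) :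
    IntegrableOn (fun z => k z * X u z) (Set.Ioo a b ×ˢ Set.Ioo c d) := by
  have hX : IntegrableOn (X u) (Set.Ioo a b ×ˢ Set.Ioo c d) := hv.congr (h.X_ae_eq hab hu hv).symm
  obtain ⟨C, hC⟩ := (isCompact_Icc (a := a) (b := b)).prod (isCompact_Icc (a := c) (b := d))
    |>.exists_bound_of_continuousOn hk.continuousOn
  refine hX.bdd_mul (c := C) hk.aestronglyMeasurable ?_
  rw [ae_restrict_iff' (measurableSet_Ioo.prod measurableSet_Ioo)]
  exact Eventually.of_forall fun z hz =>
    hC z (Set.prod_mono Set.Ioo_subset_Icc_self Set.Ioo_subset_Icc_self hz)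

/-- One statement serves every side of the Cauchy–Riemann identities: `ψ` is `phi` or the identity,
and after swapping coordinates `w` is the Jacobian `|x|^α`. -/
lemma HasWeakDerivOn.integral_rect {a b c d : ℝ} (hab : a < b)
    {u v : ℝ × ℝ → ℝ} (hu : Continuous u)
    (h : HasWeakDerivOn (Set.Ioo a b ×ˢ Set.Ioo c d) (1, 0) u v)
    (hv : IntegrableOn v (Set.Ioo a b ×ˢ Set.Ioo c d))
    {ψ : ℝ → ℝ} (hψ : ContDiff ℝ 1 ψ) (w : ℝ → ℝ) {a' b' c' d' : ℝ}
    (ha' : a' ∈ Set.Icc a b) (hb' : b' ∈ Set.Icc a b) (hc' : c' ∈ Set.Icc c d)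
    (hd' : d' ∈ Set.Icc c d) :
    ∫ y in c'..d', w y * (ψ (u (b', y)) - ψ (u (a', y))) =
      ∫ y in c'..d', ∫ x in a'..b', w y * (deriv ψ (u (x, y)) * X u (x, y)) := by
  apply intervalIntegral.integral_congr_ae
  -- The interval integral includes its right endpoint, whereas the weak derivative lives on the
  -- open rectangle.
  have hne : ∀ᵐ y : ℝ, y ≠ d := by simp [ae_iff, measure_singleton]
  filter_upwards [h.ae_absolutelyContinuousOnInterval hab hu hv, hne] with y hy hyd hyJ
  have hyJ' : y ∈ Set.Ioo c d := by
    have h1 : min c' d' < y := hyJ.1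
    have h2 : y ≤ max c' d' := hyJ.2
    refine ⟨lt_of_le_of_lt (le_min hc'.1 hd'.1) h1, lt_of_le_of_ne (h2.trans ?_) hyd⟩
    exact max_le hc'.2 hd'.2
  have h1 : AbsolutelyContinuousOnInterval (fun x => u (x, y)) a' b' :=
    (hy hyJ').mono (Set.uIcc_subset_uIcc (by rwa [Set.uIcc_of_le hab.le])
      (by rwa [Set.uIcc_of_le hab.le]))
  rw [intervalIntegral.integral_const_mul,
    ← (absolutelyContinuousOnInterval_comp h1 hψ).integral_deriv_eq_sub]
  congr 1
  apply intervalIntegral.integral_congr_ae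
  filter_upwards [h1.ae_differentiableAt] with x hx hxI
  have h2 := (hx (Set.uIoc_subset_uIcc hxI)).hasDerivAt
  exact (((hψ.differentiable (by simp)) (u (x, y))).hasDerivAt.comp x h2).deriv

lemma HasWeakDerivOn.swap {U : Set (ℝ × ℝ)} {e : ℝ × ℝ} {u v : ℝ × ℝ → ℝ}
    (h : HasWeakDerivOn U e u v) :
    HasWeakDerivOn (Prod.swap ⁻¹' U) e.swap (u ∘ Prod.swap) (v ∘ Prod.swap) := by
  have hmp : MeasurePreserving (Prod.swap : ℝ × ℝ → ℝ × ℝ) volume volume :=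
    Measure.measurePreserving_swap
  have hemb : MeasurableEmbedding (Prod.swap : ℝ × ℝ → ℝ × ℝ) :=
    (Homeomorph.prodComm ℝ ℝ).measurableEmbedding
  have hloc (f : ℝ × ℝ → ℝ) (hf : LocallyIntegrableOn f U) :
      LocallyIntegrableOn (f ∘ Prod.swap) (Prod.swap ⁻¹' U) := by
    intro x hx
    obtain ⟨t, ht, hft⟩ := hf x.swap hx
    refine ⟨Prod.swap ⁻¹' t, ?_, (hmp.integrableOn_comp_preimage hemb).2 hft⟩
    exact (continuous_swap.continuousWithinAt.tendsto_nhdsWithin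
      (Set.mapsTo_preimage Prod.swap U)) ht
  refine ⟨hloc u h.1, hloc v h.2.1, fun φ h1 h2 h3 => ?_⟩
  have hφ1 : ContDiff ℝ ∞ (φ ∘ Prod.swap) := h1.comp (contDiff_snd.prodMk contDiff_fst)
  have hsupp : tsupport (φ ∘ Prod.swap) = Prod.swap ⁻¹' tsupport φ :=
    tsupport_comp_eq_preimage φ (Homeomorph.prodComm ℝ ℝ)
  have hφ2 : HasCompactSupport (φ ∘ Prod.swap) := h2.comp_homeomorph (Homeomorph.prodComm ℝ ℝ)
  have hφ3 : tsupport (φ ∘ Prod.swap) ⊆ U := by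
    rw [hsupp]
    intro z hz
    exact h3 hz
  have key := h.2.2 _ hφ1 hφ2 hφ3
  have hfd (z : ℝ × ℝ) : fderiv ℝ (φ ∘ Prod.swap) z e = fderiv ℝ φ z.swap e.swap := by
    have h4 : HasFDerivAt (Prod.swap : ℝ × ℝ → ℝ × ℝ)
        ((ContinuousLinearEquiv.prodComm ℝ ℝ ℝ : (ℝ × ℝ) →L[ℝ] ℝ × ℝ)) z :=
      (ContinuousLinearEquiv.prodComm ℝ ℝ ℝ).hasFDerivAt
    have h5 := ((h1.differentiable (by simp)) z.swap).hasFDerivAt.comp z h4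
    rw [h5.fderiv]
    rfl
  have e1 := hmp.setIntegral_preimage_emb hemb
    (fun z => u z * fderiv ℝ (φ ∘ Prod.swap) z e) U
  have e2 := hmp.setIntegral_preimage_emb hemb (fun z => v z * (φ ∘ Prod.swap) z) U
  rw [← e1, ← e2] at key
  simpa [hfd] using key

lemma swap_preimage_prod (s t : Set ℝ) : (Prod.swap ⁻¹' (s ×ˢ t) : Set (ℝ × ℝ)) = t ×ˢ s := by
  ext z
  simp [and_comm]

lemma integrableOn_comp_swap {f : ℝ × ℝ → ℝ} {s t : Set ℝ} :
    IntegrableOn (f ∘ Prod.swap) (t ×ˢ s) ↔ IntegrableOn f (s ×ˢ t) := by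
  rw [← swap_preimage_prod]
  exact (Measure.measurePreserving_swap (μ := (volume : Measure ℝ))
    (ν := (volume : Measure ℝ))).integrableOn_comp_preimage
    (Homeomorph.prodComm ℝ ℝ).measurableEmbedding

lemma HasWeakDerivOn.integral_rect' {a b c d : ℝ} (hcd : c < d)
    {u v : ℝ × ℝ → ℝ} (hu : Continuous u)
    (h : HasWeakDerivOn (Set.Ioo a b ×ˢ Set.Ioo c d) (0, 1) u v)
    (hv : IntegrableOn v (Set.Ioo a b ×ˢ Set.Ioo c d))
    {ψ : ℝ → ℝ} (hψ : ContDiff ℝ 1 ψ) (w : ℝ → ℝ) {a' b' c' d' : ℝ}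
    (ha' : a' ∈ Set.Icc a b) (hb' : b' ∈ Set.Icc a b) (hc' : c' ∈ Set.Icc c d)
    (hd' : d' ∈ Set.Icc c d) :
    ∫ x in a'..b', w x * (ψ (u (x, d')) - ψ (u (x, c'))) =
      ∫ x in a'..b', ∫ y in c'..d', w x * (deriv ψ (u (x, y)) * partialY u (x, y)) := by
  have h' := h.swap
  rw [swap_preimage_prod] at h'
  exact h'.integral_rect hcd (hu.comp continuous_swap) (integrableOn_comp_swap.2 hv) hψ w
    hc' hd' ha' hb'

/-! ### Vanishing of partial derivatives on zero sets -/

/-- Zeros of a function at which its derivative does not vanish are isolated, hence countable. -/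
lemma countable_zeros_deriv_ne_zero (f : ℝ → ℝ) : {t | f t = 0 ∧ deriv f t ≠ 0}.Countable := by
  set T := {t | f t = 0 ∧ deriv f t ≠ 0}
  have : DiscreteTopology T := by
    rw [discreteTopology_subtype_iff]
    intro t ht
    have hd : HasDerivAt f (deriv f t) t := (differentiableAt_of_deriv_ne_zero ht.2).hasDerivAt
    have h1 := hd.eventually_ne ht.2 (c := 0)
    rw [← disjoint_iff]
    rw [Filter.disjoint_principal_right]
    filter_upwards [h1] with s hs hsT
    exact hs hsT.1
  -- A discrete subspace of the line is separable, hence countable.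
  exact Set.countable_coe_iff.1 (TopologicalSpace.separableSpace_iff_countable.1 inferInstance)

lemma ae_X_eq_zero_of_eq_zero {u : ℝ × ℝ → ℝ} (hu : Continuous u) :
    ∀ᵐ z, u z = 0 → X u z = 0 := by
  have hm : MeasurableSet {z : ℝ × ℝ | u z = 0 → X u z = 0} :=
    (measurableSet_eq_fun hu.measurable measurable_const).imp
      (measurableSet_eq_fun (measurable_X hu) measurable_const)
  rw [Measure.volume_eq_prod, Measure.ae_prod_iff_ae_ae hm,
    Measure.ae_ae_comm (p := fun x y => u (x, y) = 0 → X u (x, y) = 0) hm]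
  refine Eventually.of_forall fun y => ?_
  have h0 := (countable_zeros_deriv_ne_zero fun t => u (t, y)).measure_zero volume
  rw [ae_iff]
  convert h0 using 2
  ext t
  simp [X]

lemma ae_partialY_eq_zero_of_eq_zero {u : ℝ × ℝ → ℝ} (hu : Continuous u) :
    ∀ᵐ z, u z = 0 → partialY u z = 0 := by
  have h1 := ae_X_eq_zero_of_eq_zero (hu.comp continuous_swap)
  exact (Measure.measurePreserving_swap (μ := (volume : Measure ℝ))
    (ν := (volume : Measure ℝ))).quasiMeasurePreserving.ae h1

/-! ### The coordinates `phi` and `Phi` -/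

/-- The change of variable `x ↦ x |x|^α / (α + 1)`, a primitive of `|x|^α`. -/
noncomputable def phi (α x : ℝ) : ℝ := x * |x| ^ α / (α + 1)

lemma phi_neg (α x : ℝ) : phi α (-x) = -phi α x := by
  simp only [phi, abs_neg]
  ring

lemma phi_of_nonneg {α x : ℝ} (hα : 0 < α) (hx : 0 ≤ x) :
    phi α x = x ^ (α + 1) / (α + 1) := by
  rw [phi, abs_of_nonneg hx, Real.rpow_add_one' hx (by linarith), mul_comm]

lemma abs_phi {α : ℝ} (hα : 0 < α) (x : ℝ) : |phi α x| = |x| ^ (α + 1) / (α + 1) := by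
  have h1 : 0 ≤ phi α |x| := by
    unfold phi
    positivity
  rw [← phi_of_nonneg hα (abs_nonneg x), ← abs_of_nonneg h1]
  rcases abs_choice x with h | h <;> simp [h, phi_neg]

lemma phi_zero (α : ℝ) : phi α 0 = 0 := by simp [phi]

lemma continuous_abs_rpow {α : ℝ} (hα : 0 < α) : Continuous fun x : ℝ => |x| ^ α :=
  continuous_abs.rpow_const fun _ => Or.inr hα.le

lemma continuous_phi {α : ℝ} (hα : 0 < α) : Continuous (phi α) :=
  (continuous_id.mul (continuous_abs_rpow hα)).div_const _

lemma hasDerivAt_phi {α : ℝ} (hα : 0 < α) (x : ℝ) : HasDerivAt (phi α) (|x| ^ α) x := by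
  have hpos : ∀ x : ℝ, 0 < x → HasDerivAt (phi α) (|x| ^ α) x := by
    intro x hx
    have h1 : HasDerivAt (fun x : ℝ => x ^ (α + 1) / (α + 1)) (|x| ^ α) x := by
      have := (Real.hasDerivAt_rpow_const (x := x) (p := α + 1) (Or.inl hx.ne')).div_const (α + 1)
      have h2 : (α + 1) * x ^ (α + 1 - 1) / (α + 1) = |x| ^ α := by
        rw [abs_of_pos hx, add_sub_cancel_right]
        field_simp
      rwa [h2] at this
    refine h1.congr_of_eventuallyEq ?_
    filter_upwards [lt_mem_nhds hx] with t ht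
    exact phi_of_nonneg hα ht.le
  have hne : ∀ x : ℝ, x ≠ 0 → HasDerivAt (phi α) (|x| ^ α) x := by
    intro x hx
    rcases lt_or_gt_of_ne hx with h | h
    · have h1 := (hpos (-x) (by linarith)).comp x (hasDerivAt_neg x)
      have h2 := h1.neg
      have h3 : -(phi α ∘ Neg.neg) = phi α := by
        ext t
        simp [phi_neg]
      rw [h3] at h2
      simpa using h2
    · exact hpos x h
  rcases eq_or_ne x 0 with rfl | hx
  -- At the origin the derivative is the limit of the derivatives at nearby points.
  · exact hasDerivAt_of_hasDerivAt_of_ne (g := fun x : ℝ => |x| ^ α) (fun y hy => hne y hy)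
      (continuous_phi hα).continuousAt (continuous_abs_rpow hα).continuousAt
  · exact hne x hx

lemma deriv_phi {α : ℝ} (hα : 0 < α) : deriv (phi α) = fun x => |x| ^ α :=
  funext fun x => (hasDerivAt_phi hα x).deriv

lemma contDiff_phi {α : ℝ} (hα : 0 < α) : ContDiff ℝ 1 (phi α) := by
  rw [contDiff_one_iff_deriv, deriv_phi hα]
  exact ⟨fun x => (hasDerivAt_phi hα x).differentiableAt, continuous_abs_rpow hα⟩

lemma strictMono_phi {α : ℝ} (hα : 0 < α) : StrictMono (phi α) := by
  apply strictMono_of_odd_strictMonoOn_nonneg (phi_neg α)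
  intro x hx y hy hxy
  rw [phi_of_nonneg hα hx, phi_of_nonneg hα hy]
  have := Real.rpow_lt_rpow hx hxy (show 0 < α + 1 by linarith)
  gcongr

lemma surjective_phi {α : ℝ} (hα : 0 < α) : Function.Surjective (phi α) := by
  have hα1 : 0 < α + 1 := by linarith
  have hnonneg : ∀ u : ℝ, 0 ≤ u → ∃ x, phi α x = u := by
    intro u hu
    refine ⟨((α + 1) * u) ^ (α + 1)⁻¹, ?_⟩
    rw [phi_of_nonneg hα (by positivity), Real.rpow_inv_rpow (by positivity) hα1.ne']
    field_simp
  intro u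
  rcases le_total 0 u with h | h
  · exact hnonneg u h
  · obtain ⟨x, hx⟩ := hnonneg (-u) (by linarith)
    exact ⟨-x, by rw [phi_neg, hx, neg_neg]⟩

/-- `phi` as a homeomorphism of the line. -/
noncomputable def phiHomeo {α : ℝ} (hα : 0 < α) : ℝ ≃ₜ ℝ :=
  ((strictMono_phi hα).orderIsoOfSurjective _ (surjective_phi hα)).toHomeomorph

lemma phiHomeo_apply {α : ℝ} (hα : 0 < α) (x : ℝ) : phiHomeo hα x = phi α x := rfl

lemma phi_eq_zero {α : ℝ} (hα : 0 < α) {x : ℝ} : phi α x = 0 ↔ x = 0 :=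
  ⟨fun h => (strictMono_phi hα).injective (h.trans (phi_zero α).symm), fun h => by rw [h, phi_zero]⟩

/-- The homeomorphism `(x, y) ↦ phi x + i y` of the Grushin plane onto `ℂ`. -/
noncomputable def Phi {α : ℝ} (hα : 0 < α) : (ℝ × ℝ) ≃ₜ ℂ :=
  ((phiHomeo hα).prodCongr (Homeomorph.refl ℝ)).trans
    Complex.equivRealProdCLM.symm.toHomeomorph

lemma Phi_apply {α : ℝ} (hα : 0 < α) (z : ℝ × ℝ) : Phi hα z = ⟨phi α z.1, z.2⟩ := by
  apply Complex.ext <;> simp [Phi, phiHomeo_apply]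

@[simp] lemma Phi_re {α : ℝ} (hα : 0 < α) (z : ℝ × ℝ) : (Phi hα z).re = phi α z.1 := by
  rw [Phi_apply]

@[simp] lemma Phi_im {α : ℝ} (hα : 0 < α) (z : ℝ × ℝ) : (Phi hα z).im = z.2 := by
  rw [Phi_apply]

lemma Phi_eq {α : ℝ} (hα : 0 < α) (z : ℝ × ℝ) : Phi hα z = (phi α z.1 : ℂ) + z.2 * Complex.I := by
  apply Complex.ext <;> simp

/-! ### From weak Cauchy–Riemann equations to holomorphy -/

lemma restrict_Ioo_prod_eq (a b c d : ℝ) :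
    (volume : Measure (ℝ × ℝ)).restrict (Set.Ioo a b ×ˢ Set.Ioo c d) =
      volume.restrict (Set.Icc a b ×ˢ Set.Icc c d) := by
  rw [volume_restrict_prod, volume_restrict_prod, restrict_Ioo_eq_restrict_Icc,
    restrict_Ioo_eq_restrict_Icc]

lemma intervalIntegral_swap_congr {a b c d : ℝ} {f f' : ℝ × ℝ → ℝ}
    (hf : IntegrableOn f (Set.Ioo a b ×ˢ Set.Ioo c d))
    (hff' : f =ᵐ[volume.restrict (Set.Ioo a b ×ˢ Set.Ioo c d)] f') {a' b' c' d' : ℝ}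
    (ha' : a' ∈ Set.Icc a b) (hb' : b' ∈ Set.Icc a b) (hc' : c' ∈ Set.Icc c d)
    (hd' : d' ∈ Set.Icc c d) :
    ∫ y in c'..d', ∫ x in a'..b', f (x, y) = ∫ x in a'..b', ∫ y in c'..d', f' (x, y) := by
  have hI : Set.uIoc a' b' ⊆ Set.Icc a b :=
    Set.uIoc_subset_uIcc.trans (Set.ordConnected_Icc.uIcc_subset ha' hb')
  have hJ : Set.uIoc c' d' ⊆ Set.Icc c d :=
    Set.uIoc_subset_uIcc.trans (Set.ordConnected_Icc.uIcc_subset hc' hd')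
  have hsub := Set.prod_mono hI hJ
  rw [IntegrableOn, restrict_Ioo_prod_eq] at hf
  rw [restrict_Ioo_prod_eq] at hff'
  rw [← intervalIntegral_intervalIntegral_swap (F := fun x y => f (x, y))
    (IntegrableOn.mono_set hf hsub)]
  have h1 := ae_restrict_of_ae_restrict_of_subset hsub hff'
  rw [volume_restrict_prod] at h1
  have h2 := Measure.ae_ae_of_ae_prod h1
  rw [ae_restrict_iff' measurableSet_uIoc] at h2
  apply intervalIntegral.integral_congr_ae
  filter_upwards [h2] with x hx hxI
  apply intervalIntegral.integral_congr_ae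
  exact (ae_restrict_iff' measurableSet_uIoc).1 (hx hxI)

lemma intervalIntegral_ofReal_add_mul_I {p q : ℝ → ℝ} (hp : Continuous p) (hq : Continuous q)
    (a b : ℝ) : ∫ t in a..b, ((p t : ℂ) + q t * Complex.I) =
      ((∫ t in a..b, p t : ℝ) : ℂ) + (∫ t in a..b, q t : ℝ) * Complex.I := by
  have hp' : Continuous fun t => (p t : ℂ) := by fun_prop
  have hq' : Continuous fun t => (q t : ℂ) * Complex.I := by fun_prop
  rw [intervalIntegral.integral_add (hp'.intervalIntegrable _ _) (hq'.intervalIntegrable _ _),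
    intervalIntegral.integral_mul_const, intervalIntegral.integral_ofReal,
    intervalIntegral.integral_ofReal]

/-- **Weak Cauchy–Riemann system of the Grushin plane.** A continuous map with integrable weak
derivatives whose pointwise partial derivatives satisfy the Grushin Cauchy–Riemann equations almost
everywhere on a rectangle is holomorphic after conjugation with `Phi`. -/
theorem differentiableOn_of_cauchyRiemann {α : ℝ} (hα : 0 < α) {a b c d : ℝ} (hab : a < b)
    (hcd : c < d) {u₁ u₂ : ℝ × ℝ → ℝ} (hu₁ : Continuous u₁) (hu₂ : Continuous u₂)
    {v₁₁ v₁₂ v₂₁ v₂₂ : ℝ × ℝ → ℝ}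
    (h₁₁ : HasWeakDerivOn (Set.Ioo a b ×ˢ Set.Ioo c d) (1, 0) u₁ v₁₁)
    (h₁₂ : HasWeakDerivOn (Set.Ioo a b ×ˢ Set.Ioo c d) (0, 1) u₁ v₁₂)
    (h₂₁ : HasWeakDerivOn (Set.Ioo a b ×ˢ Set.Ioo c d) (1, 0) u₂ v₂₁)
    (h₂₂ : HasWeakDerivOn (Set.Ioo a b ×ˢ Set.Ioo c d) (0, 1) u₂ v₂₂)
    (i₁₁ : IntegrableOn v₁₁ (Set.Ioo a b ×ˢ Set.Ioo c d))
    (i₁₂ : IntegrableOn v₁₂ (Set.Ioo a b ×ˢ Set.Ioo c d))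
    (i₂₁ : IntegrableOn v₂₁ (Set.Ioo a b ×ˢ Set.Ioo c d))
    (i₂₂ : IntegrableOn v₂₂ (Set.Ioo a b ×ˢ Set.Ioo c d))
    (hCR : ∀ᵐ z ∂(volume.restrict (Set.Ioo a b ×ˢ Set.Ioo c d)),
      |u₁ z| ^ α * X u₁ z = Y α u₂ z ∧ |u₁ z| ^ α * Y α u₁ z = -X u₂ z) :
    DifferentiableOn ℂ (fun w => Phi hα (u₁ ((Phi hα).symm w), u₂ ((Phi hα).symm w)))
      (Phi hα '' (Set.Ioo a b ×ˢ Set.Ioo c d)) := by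
  have hφ := hasDerivAt_phi hα
  have hφc := continuous_phi hα
  have hac := continuous_abs_rpow hα
  set F : ℂ → ℂ := fun w => Phi hα (u₁ ((Phi hα).symm w), u₂ ((Phi hα).symm w)) with hF
  have hopen : IsOpen (Phi hα '' (Set.Ioo a b ×ˢ Set.Ioo c d)) :=
    (Phi hα).isOpenMap _ (isOpen_Ioo.prod isOpen_Ioo)
  -- Morera's theorem: it remains to check integrals around rectangles, whose preimages under `Phi`
  -- are again rectangles.
  rw [← Complex.isConservativeOn_and_continuousOn_iff_isDifferentiableOn hopen]
  have hFc : Continuous F := by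
    have h1 := (Phi hα).continuous
    have h2 := (Phi hα).symm.continuous
    fun_prop
  refine ⟨?_, hFc.continuousOn⟩
  intro z w hzw
  have hz : z ∈ Phi hα '' (Set.Ioo a b ×ˢ Set.Ioo c d) := hzw (by simp [Complex.Rectangle,
    Complex.mem_reProdIm])
  have hw : w ∈ Phi hα '' (Set.Ioo a b ×ˢ Set.Ioo c d) := hzw (by simp [Complex.Rectangle,
    Complex.mem_reProdIm])
  obtain ⟨⟨a', c'⟩, ⟨ha', hc'⟩, rfl⟩ := hz
  obtain ⟨⟨b', d'⟩, ⟨hb', hd'⟩, rfl⟩ := hw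
  replace ha' := Set.Ioo_subset_Icc_self ha'
  replace hb' := Set.Ioo_subset_Icc_self hb'
  replace hc' := Set.Ioo_subset_Icc_self hc'
  replace hd' := Set.Ioo_subset_Icc_self hd'
  simp only at ha' hb' hc' hd'
  -- `E1` is the imaginary part of the vanishing contour integral and `E2` the real part; each is
  -- one Cauchy–Riemann equation integrated over the rectangle.
  have E1 : ∫ y in c'..d', (phi α (u₁ (b', y)) - phi α (u₁ (a', y))) =
      ∫ x in a'..b', |x| ^ α * (u₂ (x, d') - u₂ (x, c')) := by
    have e1 := h₁₁.integral_rect hab hu₁ i₁₁ (contDiff_phi hα) (fun _ => 1) ha' hb' hc' hd'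
    have e2 := h₂₂.integral_rect' hcd hu₂ i₂₂ (contDiff_id (𝕜 := ℝ)) (fun x => |x| ^ α)
      ha' hb' hc' hd'
    simp only [one_mul, deriv_phi hα] at e1
    simp only [id_eq, deriv_id', one_mul] at e2
    rw [e1, e2]
    refine intervalIntegral_swap_congr (f := fun z => |u₁ z| ^ α * X u₁ z)
      (f' := fun z => |z.1| ^ α * partialY u₂ z) ?_ ?_ ha' hb' hc' hd'
    · exact h₁₁.integrableOn_mul_X hab hu₁ i₁₁ (hac.comp hu₁)
    · filter_upwards [hCR] with z hz
      exact hz.1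
  have E2 : ∫ y in c'..d', (u₂ (b', y) - u₂ (a', y)) =
      -∫ x in a'..b', |x| ^ α * (phi α (u₁ (x, d')) - phi α (u₁ (x, c'))) := by
    have e1 := h₂₁.integral_rect hab hu₂ i₂₁ (contDiff_id (𝕜 := ℝ)) (fun _ => 1) ha' hb' hc' hd'
    have e2 := h₁₂.integral_rect' hcd hu₁ i₁₂ (contDiff_phi hα) (fun x => |x| ^ α)
      ha' hb' hc' hd'
    simp only [id_eq, deriv_id', one_mul] at e1
    simp only [deriv_phi hα] at e2
    rw [e1, e2, ← intervalIntegral.integral_neg]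
    simp_rw [← intervalIntegral.integral_neg]
    refine intervalIntegral_swap_congr (f := X u₂)
      (f' := fun z => -(|z.1| ^ α * (|u₁ z| ^ α * partialY u₁ z))) ?_ ?_ ha' hb' hc' hd'
    · simpa using h₂₁.integrableOn_mul_X hab hu₂ i₂₁ (continuous_const (y := (1 : ℝ)))
    · filter_upwards [hCR] with z hz
      have := hz.2
      rw [Y_eq] at this
      linarith
  have hFval (x y : ℝ) : F ((phi α x : ℂ) + y * Complex.I) =
      (phi α (u₁ (x, y)) : ℂ) + u₂ (x, y) * Complex.I := by
    have : (phi α x : ℂ) + y * Complex.I = Phi hα (x, y) := (Phi_eq hα (x, y)).symm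
    rw [this, hF]
    simp only [Homeomorph.symm_apply_apply]
    exact Phi_eq hα _
  -- The substitution `s = phi x` produces the weight `|x|^α` on horizontal sides.
  have hhor (y : ℝ) : ∫ s in (phi α a')..(phi α b'), F (s + y * Complex.I) =
      ((∫ x in a'..b', |x| ^ α * phi α (u₁ (x, y)) : ℝ) : ℂ) +
        (∫ x in a'..b', |x| ^ α * u₂ (x, y) : ℝ) * Complex.I := by
    rw [← intervalIntegral_ofReal_add_mul_I (by fun_prop) (by fun_prop)]
    rw [← intervalIntegral.integral_deriv_smul_comp (f := phi α) (f' := fun x => |x| ^ α)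
      (g := fun s : ℝ => F (s + y * Complex.I)) (fun x _ => hφ x) hac.continuousOn (by fun_prop)]
    congr 1
    ext x
    simp only [Function.comp, hFval]
    rw [Complex.real_smul]
    push_cast
    ring
  have hver (x : ℝ) : ∫ y in c'..d', F (phi α x + y * Complex.I) =
      ((∫ y in c'..d', phi α (u₁ (x, y)) : ℝ) : ℂ) +
        (∫ y in c'..d', u₂ (x, y) : ℝ) * Complex.I := by
    rw [← intervalIntegral_ofReal_add_mul_I (by fun_prop) (by fun_prop)]
    simp only [hFval]
  rw [← add_eq_zero_iff_eq_neg, Complex.wedgeIntegral_add_wedgeIntegral_eq]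
  simp only [Phi_re, Phi_im, hhor, hver, smul_eq_mul]
  have hii (f : ℝ → ℝ) (hf : Continuous f) (s t : ℝ) : IntervalIntegrable f volume s t :=
    hf.intervalIntegrable s t
  simp only [mul_sub] at E1 E2
  rw [intervalIntegral.integral_sub (hii _ (by fun_prop) _ _) (hii _ (by fun_prop) _ _),
    intervalIntegral.integral_sub (hii _ (by fun_prop) _ _) (hii _ (by fun_prop) _ _)] at E1 E2
  apply Complex.ext
  · simp
    linarith
  · simp
    linarith

/-! ### The conjugated map, and its holomorphy for conformal `g` -/

/-- The map `g` read in the coordinates `Phi` of the source and of the target. -/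
noncomputable def conjMap {α : ℝ} (hα : 0 < α) (g : OpenPartialHomeomorph (ℝ × ℝ) (ℝ × ℝ)) :
    OpenPartialHomeomorph ℂ ℂ :=
  ((Phi hα).symm.transOpenPartialHomeomorph g).transHomeomorph (Phi hα)

lemma conjMap_apply {α : ℝ} (hα : 0 < α) (g : OpenPartialHomeomorph (ℝ × ℝ) (ℝ × ℝ)) (w : ℂ) :
    conjMap hα g w = Phi hα (g ((Phi hα).symm w)) := rfl

lemma conjMap_Phi {α : ℝ} (hα : 0 < α) (g : OpenPartialHomeomorph (ℝ × ℝ) (ℝ × ℝ)) (z : ℝ × ℝ) :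
    conjMap hα g (Phi hα z) = Phi hα (g z) := by
  rw [conjMap_apply, Homeomorph.symm_apply_apply]

lemma conjMap_source {α : ℝ} (hα : 0 < α) (g : OpenPartialHomeomorph (ℝ × ℝ) (ℝ × ℝ)) :
    (conjMap hα g).source = (Phi hα).symm ⁻¹' g.source := rfl

lemma Phi_mem_conjMap_source {α : ℝ} (hα : 0 < α) {g : OpenPartialHomeomorph (ℝ × ℝ) (ℝ × ℝ)}
    {z : ℝ × ℝ} : Phi hα z ∈ (conjMap hα g).source ↔ z ∈ g.source := by
  rw [conjMap_source, Set.mem_preimage, Homeomorph.symm_apply_apply]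

lemma X_congr {u u' : ℝ × ℝ → ℝ} {z : ℝ × ℝ} (h : u =ᶠ[𝓝 z] u') : X u z = X u' z := by
  apply EventuallyEq.deriv_eq
  exact (Continuous.tendsto' (f := fun t : ℝ => (t, z.2)) (by fun_prop) z.1 z rfl).eventually h

lemma partialY_congr {u u' : ℝ × ℝ → ℝ} {z : ℝ × ℝ} (h : u =ᶠ[𝓝 z] u') :
    partialY u z = partialY u' z := by
  apply EventuallyEq.deriv_eq
  exact (Continuous.tendsto' (f := fun t : ℝ => (z.1, t)) (by fun_prop) z.2 z rfl).eventually h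

lemma Y_congr {α : ℝ} {u u' : ℝ × ℝ → ℝ} {z : ℝ × ℝ} (h : u =ᶠ[𝓝 z] u') :
    Y α u z = Y α u' z := by
  rw [Y_eq, Y_eq, partialY_congr h]

lemma mem_regularSet {Ω : Set (ℝ × ℝ)} {f : ℝ × ℝ → ℝ × ℝ} {z : ℝ × ℝ} :
    z ∈ regularSet Ω f ↔ z ∈ Ω ∧ z.1 ≠ 0 ∧ (f z).1 ≠ 0 := by
  simp only [regularSet, singularSet, Set.mem_sdiff, Set.mem_ofPred_eq, not_and, not_or]
  tauto

lemma isOpen_regularSet (g : OpenPartialHomeomorph (ℝ × ℝ) (ℝ × ℝ)) :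
    IsOpen (regularSet g.source g) := by
  have h : regularSet g.source g =
      (g.source ∩ g ⁻¹' {z | z.1 ≠ 0}) ∩ {z | z.1 ≠ 0} := by
    ext z
    rw [mem_regularSet]
    simp only [Set.mem_inter_iff, Set.mem_preimage, Set.mem_ofPred_eq]
    tauto
  have ho : IsOpen {z : ℝ × ℝ | z.1 ≠ 0} := isOpen_ne.preimage continuous_fst
  rw [h]
  exact (g.isOpen_inter_preimage ho).inter ho

lemma ae_fst_ne_zero : ∀ᵐ z : ℝ × ℝ, z.1 ≠ 0 := by
  rw [Measure.volume_eq_prod]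
  have h : ∀ᵐ x : ℝ, x ≠ 0 := by simp [ae_iff, measure_singleton]
  exact Measure.quasiMeasurePreserving_fst.ae h

lemma det_DH (α : ℝ) (f : ℝ × ℝ → ℝ × ℝ) (z : ℝ × ℝ) : (DH α f z).det =
    X (fun w => (f w).1) z * Y α (fun w => (f w).2) z -
      Y α (fun w => (f w).1) z * X (fun w => (f w).2) z := by
  simp [DH, Matrix.det_fin_two_of]

/-- An orientation preserving similarity satisfies the Cauchy–Riemann equations. -/
lemma cauchyRiemann_of_Dα_eq {α : ℝ} {f : ℝ × ℝ → ℝ × ℝ} {z : ℝ × ℝ} (hf : (f z).1 ≠ 0)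
    (hdet : 0 < (DH α f z).det) {c : ℝ} (hc : 0 < c) {O : Matrix (Fin 2) (Fin 2) ℝ}
    (hO : O ∈ Matrix.orthogonalGroup (Fin 2) ℝ) (h : Dα α f z = c • O) :
    |(f z).1| ^ α * X (fun w => (f w).1) z = Y α (fun w => (f w).2) z ∧
      |(f z).1| ^ α * Y α (fun w => (f w).1) z = -X (fun w => (f w).2) z := by
  rw [det_DH] at hdet
  have hk : 0 < |(f z).1| ^ α := Real.rpow_pos_of_pos (abs_pos.2 hf) _
  have e00 := congrFun (congrFun h 0) 0
  have e01 := congrFun (congrFun h 0) 1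
  have e10 := congrFun (congrFun h 1) 0
  have e11 := congrFun (congrFun h 1) 1
  simp only [Dα, Matrix.of_apply, Matrix.cons_val', Matrix.cons_val_zero, Matrix.cons_val_one,
    Matrix.cons_val_fin_one, Matrix.smul_apply, smul_eq_mul] at e00 e01 e10 e11
  rw [div_eq_iff hk.ne'] at e10 e11
  rw [Matrix.mem_orthogonalGroup_iff] at hO
  have o00 := congrFun (congrFun hO 0) 0
  have o01 := congrFun (congrFun hO 0) 1
  have o11 := congrFun (congrFun hO 1) 1
  simp only [Matrix.mul_apply, Fin.sum_univ_two, Matrix.transpose_apply,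
    Matrix.one_apply_eq] at o00 o01 o11
  rw [Matrix.one_apply_ne (by decide)] at o01
  rw [e00, e01, e10, e11] at hdet ⊢
  have hD : 0 < O 0 0 * O 1 1 - O 0 1 * O 1 0 := by
    have : 0 < (c * c * |(f z).1| ^ α) * (O 0 0 * O 1 1 - O 0 1 * O 1 0) := by
      convert hdet using 1
      ring
    exact pos_of_mul_pos_right this (by positivity)
  -- Orthogonality gives determinant ±1 and positivity selects +1. The sum of squares in `hsum` is
  -- then the sum of the squared entries minus twice the determinant, that is `2 - 2`.
  have hD1 : O 0 0 * O 1 1 - O 0 1 * O 1 0 = 1 := by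
    have : (O 0 0 * O 1 1 - O 0 1 * O 1 0) ^ 2 = 1 := by
      calc (O 0 0 * O 1 1 - O 0 1 * O 1 0) ^ 2
          = (O 0 0 * O 0 0 + O 0 1 * O 0 1) * (O 1 0 * O 1 0 + O 1 1 * O 1 1) -
            (O 0 0 * O 1 0 + O 0 1 * O 1 1) ^ 2 := by ring
        _ = 1 := by rw [o00, o01, o11]; ring
    nlinarith
  have hsum : (O 0 0 - O 1 1) ^ 2 + (O 0 1 + O 1 0) ^ 2 = 0 := by nlinarith
  have h1 : O 0 0 = O 1 1 := by nlinarith [sq_nonneg (O 0 0 - O 1 1), sq_nonneg (O 0 1 + O 1 0)]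
  have h2 : O 0 1 = -O 1 0 := by nlinarith [sq_nonneg (O 0 0 - O 1 1), sq_nonneg (O 0 1 + O 1 0)]
  rw [h1, h2]
  constructor <;> ring

/-- Tietze extension. It allows the rectangle results to be stated for globally continuous
functions. -/
lemma exists_continuous_eqOn {s : Set (ℝ × ℝ)} (hs : IsClosed s) {u : ℝ × ℝ → ℝ}
    (hu : ContinuousOn u s) : ∃ u' : ℝ × ℝ → ℝ, Continuous u' ∧ Set.EqOn u u' s := by
  obtain ⟨f, hf⟩ := ContinuousMap.exists_restrict_eq hs ⟨s.domRestrict u, hu.domRestrict⟩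
  refine ⟨f, f.continuous, fun z hz => ?_⟩
  exact (congrArg (fun k : C(s, ℝ) => k ⟨z, hz⟩) hf).symm

/-- In the coordinates `Phi`, a conformal map is holomorphic. -/
theorem IsSobolevConformal.differentiableOn_conjMap {α : ℝ} (hα : 0 < α)
    {g : OpenPartialHomeomorph (ℝ × ℝ) (ℝ × ℝ)} (hg : IsSobolevConformal α g) :
    DifferentiableOn ℂ (conjMap hα g) (conjMap hα g).source := by
  intro w₀ hw₀
  rw [conjMap_source] at hw₀
  obtain ⟨⟨hW, hdet⟩, ⟨-, hconf, -⟩, -⟩ := hg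
  set z₀ := (Phi hα).symm w₀ with hz₀
  have hz₀s : z₀ ∈ g.source := hw₀
  obtain ⟨r, hr, hball⟩ := Metric.nhds_basis_closedBall.mem_iff.1 (g.open_source.mem_nhds hz₀s)
  have hcl : closure (Metric.ball z₀ r) ⊆ Metric.closedBall z₀ r :=
    Metric.closure_ball_subset_closedBall
  obtain ⟨-, h₁, h₂⟩ := hW.2 (Metric.ball z₀ r) Metric.isOpen_ball
    ((isCompact_closedBall z₀ r).of_isClosed_subset isClosed_closure hcl) (hcl.trans hball)
  obtain ⟨-, v₁₁, v₁₂, h₁₁, h₁₂, -, -⟩ := h₁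
  obtain ⟨-, v₂₁, v₂₂, h₂₁, h₂₂, -, -⟩ := h₂
  set a := z₀.1 - r / 2
  set b := z₀.1 + r / 2
  set c := z₀.2 - r / 2
  set d := z₀.2 + r / 2
  have hab : a < b := by simp only [a, b]; linarith
  have hcd : c < d := by simp only [c, d]; linarith
  have hQball : Set.Icc a b ×ˢ Set.Icc c d ⊆ Metric.ball z₀ r := by
    rintro ⟨x, y⟩ ⟨hx, hy⟩
    rw [Metric.mem_ball, Prod.dist_eq, max_lt_iff, Real.dist_eq, Real.dist_eq, abs_lt, abs_lt]
    simp only [a, b, c, d, Set.mem_Icc] at hx hy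
    refine ⟨⟨?_, ?_⟩, ?_, ?_⟩ <;> simp only <;> linarith [hx.1, hx.2, hy.1, hy.2]
  have hQs : Set.Icc a b ×ˢ Set.Icc c d ⊆ g.source :=
    (hQball.trans Metric.ball_subset_closedBall).trans hball
  have hUQ : Set.Ioo a b ×ˢ Set.Ioo c d ⊆ Set.Icc a b ×ˢ Set.Icc c d :=
    Set.prod_mono Set.Ioo_subset_Icc_self Set.Ioo_subset_Icc_self
  have hUopen : IsOpen (Set.Ioo a b ×ˢ Set.Ioo c d) := isOpen_Ioo.prod isOpen_Ioo
  have hQcpt : IsCompact (Set.Icc a b ×ˢ Set.Icc c d) := isCompact_Icc.prod isCompact_Icc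
  have hint {v : ℝ × ℝ → ℝ} (hv : LocallyIntegrableOn v (Metric.ball z₀ r)) :
      IntegrableOn v (Set.Ioo a b ×ˢ Set.Ioo c d) :=
    (hv.integrableOn_compact_subset hQball hQcpt).mono_set hUQ
  have hgc : ContinuousOn g (Set.Icc a b ×ˢ Set.Icc c d) := g.continuousOn.mono hQs
  obtain ⟨u₁, hu₁, hgu₁⟩ := exists_continuous_eqOn hQcpt.isClosed
    (continuous_fst.comp_continuousOn hgc)
  obtain ⟨u₂, hu₂, hgu₂⟩ := exists_continuous_eqOn hQcpt.isClosed
    (continuous_snd.comp_continuousOn hgc)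
  have hev {u u' : ℝ × ℝ → ℝ} (h : Set.EqOn u u' (Set.Icc a b ×ˢ Set.Icc c d)) {z : ℝ × ℝ}
      (hz : z ∈ Set.Ioo a b ×ˢ Set.Ioo c d) : u =ᶠ[𝓝 z] u' := by
    filter_upwards [hUopen.mem_nhds hz] with y hy using h (hUQ hy)
  have hCR : ∀ᵐ z ∂(volume.restrict (Set.Ioo a b ×ˢ Set.Ioo c d)),
      |u₁ z| ^ α * X u₁ z = Y α u₂ z ∧ |u₁ z| ^ α * Y α u₁ z = -X u₂ z := by
    rw [ae_restrict_iff' (isOpen_regularSet g).measurableSet] at hconf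
    rw [ae_restrict_iff' g.open_source.measurableSet] at hdet
    rw [ae_restrict_iff' hUopen.measurableSet]
    filter_upwards [hconf, hdet, ae_fst_ne_zero, ae_X_eq_zero_of_eq_zero hu₁,
      ae_partialY_eq_zero_of_eq_zero hu₁] with z hz1 hz2 hz3 hz4 hz5 hzU
    have hzs := hQs (hUQ hzU)
    have e1 := hev hgu₁ hzU
    have e2 := hev hgu₂ hzU
    specialize hz2 hzs
    have hval : (g z).1 = u₁ z := hgu₁ (hUQ hzU)
    -- Where `g₁ = 0`, almost everywhere both partial derivatives of `g₁` vanish, so the determinant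
    -- would be zero.
    have hne : (g z).1 ≠ 0 := by
      intro h0
      rw [det_DH, Y_eq α fun w => (g w).1] at hz2
      have e3 : X (fun w => (g w).1) z = 0 := (X_congr e1).trans (hz4 (hval ▸ h0))
      have e4 : partialY (fun w => (g w).1) z = 0 := (partialY_congr e1).trans (hz5 (hval ▸ h0))
      rw [e3, e4] at hz2
      simp at hz2
    obtain ⟨k, hk, O, hO, hD⟩ := hz1 (mem_regularSet.2 ⟨hzs, hz3, hne⟩)
    have h3 := cauchyRiemann_of_Dα_eq hne hz2 hk hO hD
    rw [← hval, ← X_congr e1, ← X_congr e2, ← Y_congr e1, ← Y_congr e2]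
    exact h3
  have hUball : Set.Ioo a b ×ˢ Set.Ioo c d ⊆ Metric.ball z₀ r := hUQ.trans hQball
  have hwk {u u' v e} (h : HasWeakDerivOn (Metric.ball z₀ r) e u v)
      (hu : Set.EqOn u u' (Set.Icc a b ×ˢ Set.Icc c d)) :
      HasWeakDerivOn (Set.Ioo a b ×ˢ Set.Ioo c d) e u' v :=
    (h.mono hUball).congr hUopen.measurableSet (hu.mono hUQ)
  have key := differentiableOn_of_cauchyRiemann hα hab hcd hu₁ hu₂ (hwk h₁₁ hgu₁) (hwk h₁₂ hgu₁)
    (hwk h₂₁ hgu₂) (hwk h₂₂ hgu₂) (hint h₁₁.2.1) (hint h₁₂.2.1) (hint h₂₁.2.1) (hint h₂₂.2.1) hCR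
  have hopen : IsOpen (Phi hα '' (Set.Ioo a b ×ˢ Set.Ioo c d)) := (Phi hα).isOpenMap _ hUopen
  have hmem : w₀ ∈ Phi hα '' (Set.Ioo a b ×ˢ Set.Ioo c d) := by
    refine ⟨z₀, ⟨⟨?_, ?_⟩, ?_, ?_⟩, by rw [hz₀, Homeomorph.apply_symm_apply]⟩ <;>
      simp only [a, b, c, d] <;> linarith
  have hnhds := hopen.mem_nhds hmem
  refine (((key w₀ hmem).differentiableAt hnhds).congr_of_eventuallyEq ?_).differentiableWithinAt
  filter_upwards [hnhds] with w hw
  obtain ⟨z, hz, rfl⟩ := hw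
  rw [conjMap_Phi]
  simp only [Homeomorph.symm_apply_apply]
  rw [← hgu₁ (hUQ hz), ← hgu₂ (hUQ hz)]
  rfl

/-! ### Inverses of holomorphic homeomorphisms -/

/-- The inverse of a holomorphic homeomorphism is holomorphic. -/
theorem differentiableOn_symm (F : OpenPartialHomeomorph ℂ ℂ)
    (hF : DifferentiableOn ℂ F F.source) : DifferentiableOn ℂ F.symm F.target := by
  intro v₀ hv₀
  set w₀ := F.symm v₀ with hw₀
  have hw₀s : w₀ ∈ F.source := F.map_target hv₀
  have hd : AnalyticAt ℂ (deriv F) w₀ := (hF.analyticAt (F.open_source.mem_nhds hw₀s)).deriv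
  refine DifferentiableAt.differentiableWithinAt (AnalyticAt.differentiableAt ?_)
  -- If `F'` vanishes near `w₀` then `F` is locally constant, against injectivity. Otherwise the
  -- inverse is holomorphic off `v₀` and continuous there, so the singularity is removable.
  rcases hd.eventually_eq_zero_or_eventually_ne_zero with h | h
  · exfalso
    obtain ⟨r, hr, hball⟩ := Metric.mem_nhds_iff.1
      (inter_mem h (F.open_source.mem_nhds hw₀s))
    obtain ⟨x, hx⟩ := Metric.isOpen_ball.exists_is_const_of_deriv_eq_zero
      (convex_ball w₀ r).isPreconnected (hF.mono fun w hw => (hball hw).2)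
      (fun w hw => (hball hw).1)
    have h1 : w₀ ∈ Metric.ball w₀ r := Metric.mem_ball_self hr
    have h2 : w₀ + (r / 2 : ℝ) ∈ Metric.ball w₀ r := by
      simp [abs_of_pos hr, hr]
    have h3 := F.injOn (hball h1).2 (hball h2).2 ((hx _ h1).trans (hx _ h2).symm)
    have h4 : ((r / 2 : ℝ) : ℂ) = 0 := by
      rwa [left_eq_add] at h3
    rw [Complex.ofReal_eq_zero] at h4
    linarith
  · apply Complex.analyticAt_of_differentiable_on_punctured_nhds_of_continuousAt _
      (F.symm.continuousAt hv₀)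
    have ht : Tendsto F.symm (𝓝[≠] v₀) (𝓝[≠] w₀) := by
      refine tendsto_nhdsWithin_iff.2 ⟨(F.symm.continuousAt hv₀).tendsto.mono_left inf_le_left, ?_⟩
      filter_upwards [self_mem_nhdsWithin, mem_nhdsWithin_of_mem_nhds
        (F.open_target.mem_nhds hv₀)] with v hv hvt hcon
      exact hv (F.symm.injOn hvt hv₀ hcon)
    filter_upwards [ht.eventually h, mem_nhdsWithin_of_mem_nhds
        (F.open_target.mem_nhds hv₀)] with v hv hvt
    have h5 : HasDerivAt F (deriv F (F.symm v)) (F.symm v) :=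
      (hF.differentiableAt (F.open_source.mem_nhds (F.map_target hvt))).hasDerivAt
    exact (F.hasDerivAt_symm hvt hv h5).differentiableAt

/-- The derivative of a holomorphic homeomorphism does not vanish. -/
theorem deriv_ne_zero_of_differentiableOn (F : OpenPartialHomeomorph ℂ ℂ)
    (hF : DifferentiableOn ℂ F F.source) {w : ℂ} (hw : w ∈ F.source) : deriv F w ≠ 0 := by
  have h1 : HasDerivAt F (deriv F w) w :=
    (hF.differentiableAt (F.open_source.mem_nhds hw)).hasDerivAt
  have h2 : HasDerivAt F.symm (deriv F.symm (F w)) (F w) :=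
    ((differentiableOn_symm F hF).differentiableAt
      (F.open_target.mem_nhds (F.map_source hw))).hasDerivAt
  have h3 := h2.comp w h1
  have h4 : HasDerivAt (F.symm ∘ F) 1 w :=
    (hasDerivAt_id w).congr_of_eventuallyEq (F.eventually_left_inverse hw)
  intro h0
  have := h3.unique h4
  rw [h0, mul_zero] at this
  exact zero_ne_one this

/-! ### Partial derivatives of `g` in terms of the complex derivative -/

/-- Away from 0 the derivative of `phi` is nonzero, so `phi` can be undone by the inverse function
rule. -/
lemma hasDerivAt_of_hasDerivAt_phi_comp {α : ℝ} (hα : 0 < α) {h : ℝ → ℝ} {D t : ℝ}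
    (hD : HasDerivAt (fun s => phi α (h s)) D t) (hne : h t ≠ 0) :
    HasDerivAt h (D / |h t| ^ α) t := by
  have hpos : |h t| ^ α ≠ 0 := (Real.rpow_pos_of_pos (abs_pos.2 hne) _).ne'
  have hinv : HasDerivAt (phiHomeo hα).symm (|h t| ^ α)⁻¹ (phi α (h t)) := by
    have h1 : HasDerivAt (phiHomeo hα) (|h t| ^ α) ((phiHomeo hα).symm (phi α (h t))) := by
      rw [← phiHomeo_apply hα, Homeomorph.symm_apply_apply]
      exact hasDerivAt_phi hα _
    exact h1.of_local_left_inverse (phiHomeo hα).symm.continuous.continuousAt hpos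
      (Eventually.of_forall fun y => (phiHomeo hα).apply_symm_apply y)
  have h2 := hinv.comp t hD
  have h3 : (phiHomeo hα).symm ∘ (fun s => phi α (h s)) = h := by
    ext s
    simp [← phiHomeo_apply hα]
  rw [h3] at h2
  rwa [div_eq_inv_mul]

/-- The complex derivative, at the point `z` of the Grushin plane, of `g` read in the coordinates
`Phi`. -/
noncomputable def conjDeriv {α : ℝ} (hα : 0 < α) (g : OpenPartialHomeomorph (ℝ × ℝ) (ℝ × ℝ)) (z : ℝ × ℝ) : ℂ :=
  deriv (conjMap hα g) (Phi hα z)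

lemma hasDerivAt_conjMap {α : ℝ} (hα : 0 < α) {g : OpenPartialHomeomorph (ℝ × ℝ) (ℝ × ℝ)}
    (hF : DifferentiableOn ℂ (conjMap hα g) (conjMap hα g).source) {z : ℝ × ℝ} (hz : z ∈ g.source) :
    HasDerivAt (conjMap hα g) (conjDeriv hα g z) (Phi hα z) :=
  (hF.differentiableAt ((conjMap hα g).open_source.mem_nhds
    ((Phi_mem_conjMap_source hα).2 hz))).hasDerivAt

lemma conjDeriv_ne_zero {α : ℝ} (hα : 0 < α) {g : OpenPartialHomeomorph (ℝ × ℝ) (ℝ × ℝ)}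
    (hF : DifferentiableOn ℂ (conjMap hα g) (conjMap hα g).source) {z : ℝ × ℝ} (hz : z ∈ g.source) : conjDeriv hα g z ≠ 0 :=
  deriv_ne_zero_of_differentiableOn _ hF ((Phi_mem_conjMap_source hα).2 hz)

lemma continuousOn_conjDeriv {α : ℝ} (hα : 0 < α) {g : OpenPartialHomeomorph (ℝ × ℝ) (ℝ × ℝ)}
    (hF : DifferentiableOn ℂ (conjMap hα g) (conjMap hα g).source)
    : ContinuousOn (conjDeriv hα g) g.source := by
  have h1 : ContinuousOn (deriv (conjMap hα g)) (conjMap hα g).source :=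
    (hF.deriv (conjMap hα g).open_source).continuousOn
  exact h1.comp (Phi hα).continuous.continuousOn
    fun z hz => (Phi_mem_conjMap_source hα).2 hz

lemma hasDerivAt_Phi_fst {α : ℝ} (hα : 0 < α) {g : OpenPartialHomeomorph (ℝ × ℝ) (ℝ × ℝ)}
    (hF : DifferentiableOn ℂ (conjMap hα g) (conjMap hα g).source) {z : ℝ × ℝ} (hz : z ∈ g.source) :
    HasDerivAt (fun t => Phi hα (g (t, z.2))) (((|z.1| ^ α : ℝ) : ℂ) * conjDeriv hα g z) z.1 := by
  have h1 : HasDerivAt (fun t => Phi hα (t, z.2)) ((|z.1| ^ α : ℝ) : ℂ) z.1 := by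
    simp_rw [Phi_eq]
    exact (hasDerivAt_phi hα z.1).ofReal_comp.add_const _
  have h2 := (hasDerivAt_conjMap hα hF hz).scomp z.1 h1
  simp only [Function.comp_def, conjMap_Phi, smul_eq_mul] at h2
  exact h2

lemma hasDerivAt_Phi_snd {α : ℝ} (hα : 0 < α) {g : OpenPartialHomeomorph (ℝ × ℝ) (ℝ × ℝ)}
    (hF : DifferentiableOn ℂ (conjMap hα g) (conjMap hα g).source) {z : ℝ × ℝ} (hz : z ∈ g.source) :
    HasDerivAt (fun t => Phi hα (g (z.1, t))) (Complex.I * conjDeriv hα g z) z.2 := by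
  have h1 : HasDerivAt (fun t => Phi hα (z.1, t)) Complex.I z.2 := by
    simp_rw [Phi_eq]
    have h0 : HasDerivAt (fun t : ℝ => (t : ℂ)) 1 z.2 := (hasDerivAt_id z.2).ofReal_comp
    simpa using (h0.mul_const Complex.I).const_add (phi α z.1 : ℂ)
  have h2 := HasDerivAt.scomp (h := fun t => Phi hα (z.1, t)) z.2 (hasDerivAt_conjMap hα hF hz) h1
  simp only [Function.comp_def, conjMap_Phi, smul_eq_mul] at h2
  exact h2

lemma hasDerivAt_re {f : ℝ → ℂ} {f' : ℂ} {t : ℝ} (h : HasDerivAt f f' t) :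
    HasDerivAt (fun s => (f s).re) f'.re t :=
  Complex.reCLM.hasFDerivAt.comp_hasDerivAt t h

lemma hasDerivAt_im {f : ℝ → ℂ} {f' : ℂ} {t : ℝ} (h : HasDerivAt f f' t) :
    HasDerivAt (fun s => (f s).im) f'.im t :=
  Complex.imCLM.hasFDerivAt.comp_hasDerivAt t h

lemma hasDerivAt_fst_snd {α : ℝ} (hα : 0 < α) {g : OpenPartialHomeomorph (ℝ × ℝ) (ℝ × ℝ)}
    (hF : DifferentiableOn ℂ (conjMap hα g) (conjMap hα g).source) {z : ℝ × ℝ} (hz : z ∈ g.source) :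
    HasDerivAt (fun t => (g (t, z.2)).2) (|z.1| ^ α * (conjDeriv hα g z).im) z.1 := by
  simpa [Complex.im_ofReal_mul] using hasDerivAt_im (hasDerivAt_Phi_fst hα hF hz)

lemma hasDerivAt_snd_snd {α : ℝ} (hα : 0 < α) {g : OpenPartialHomeomorph (ℝ × ℝ) (ℝ × ℝ)}
    (hF : DifferentiableOn ℂ (conjMap hα g) (conjMap hα g).source) {z : ℝ × ℝ} (hz : z ∈ g.source) :
    HasDerivAt (fun t => (g (z.1, t)).2) (conjDeriv hα g z).re z.2 := by
  simpa using hasDerivAt_im (hasDerivAt_Phi_snd hα hF hz)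

lemma hasDerivAt_fst_fst {α : ℝ} (hα : 0 < α) {g : OpenPartialHomeomorph (ℝ × ℝ) (ℝ × ℝ)}
    (hF : DifferentiableOn ℂ (conjMap hα g) (conjMap hα g).source) {z : ℝ × ℝ} (hz : z ∈ g.source) (hne : (g z).1 ≠ 0) :
    HasDerivAt (fun t => (g (t, z.2)).1)
      (|z.1| ^ α / |(g z).1| ^ α * (conjDeriv hα g z).re) z.1 := by
  have h1 := hasDerivAt_re (hasDerivAt_Phi_fst hα hF hz)
  simp only [Phi_re, Complex.re_ofReal_mul] at h1
  have h2 := hasDerivAt_of_hasDerivAt_phi_comp hα (h := fun t => (g (t, z.2)).1) h1 hne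
  rwa [mul_div_right_comm] at h2

lemma hasDerivAt_snd_fst {α : ℝ} (hα : 0 < α) {g : OpenPartialHomeomorph (ℝ × ℝ) (ℝ × ℝ)}
    (hF : DifferentiableOn ℂ (conjMap hα g) (conjMap hα g).source) {z : ℝ × ℝ} (hz : z ∈ g.source) (hne : (g z).1 ≠ 0) :
    HasDerivAt (fun t => (g (z.1, t)).1) (-(conjDeriv hα g z).im / |(g z).1| ^ α) z.2 := by
  have h1 := hasDerivAt_re (hasDerivAt_Phi_snd hα hF hz)
  simp only [Phi_re, Complex.I_mul_re] at h1
  exact hasDerivAt_of_hasDerivAt_phi_comp hα (h := fun t => (g (z.1, t)).1) h1 hne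

/-- The real matrix of the multiplication by a complex number. -/
def mulMatrix (w : ℂ) : Matrix (Fin 2) (Fin 2) ℝ := !![w.re, -w.im; w.im, w.re]

lemma continuous_mulMatrix : Continuous mulMatrix := by
  unfold mulMatrix
  refine continuous_matrix fun i j => ?_
  fin_cases i <;> fin_cases j <;> simp <;> fun_prop

/-- Division of the second row by `|g₁|^α` gives all four entries the same scalar factor, so `Dα g`
sees `F'` as a similarity. -/
lemma Dα_eq {α : ℝ} (hα : 0 < α) {g : OpenPartialHomeomorph (ℝ × ℝ) (ℝ × ℝ)}
    (hF : DifferentiableOn ℂ (conjMap hα g) (conjMap hα g).source) {z : ℝ × ℝ} (hz : z ∈ regularSet g.source g) :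
    Dα α g z = (|z.1| ^ α / |(g z).1| ^ α) • mulMatrix (conjDeriv hα g z) := by
  obtain ⟨hzs, -, hne⟩ := mem_regularSet.1 hz
  have e1 := (hasDerivAt_fst_fst hα hF hzs hne).deriv
  have e2 := (hasDerivAt_snd_fst hα hF hzs hne).deriv
  have e3 := (hasDerivAt_fst_snd hα hF hzs).deriv
  have e4 := (hasDerivAt_snd_snd hα hF hzs).deriv
  ext i j
  fin_cases i <;> fin_cases j <;> simp [Dα, X, Y, mulMatrix, e1, e2, e3, e4] <;> ring

lemma det_DH_eq {α : ℝ} (hα : 0 < α) {g : OpenPartialHomeomorph (ℝ × ℝ) (ℝ × ℝ)}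
    (hF : DifferentiableOn ℂ (conjMap hα g) (conjMap hα g).source) {z : ℝ × ℝ} (hz : z ∈ regularSet g.source g) :
    (DH α g z).det = |z.1| ^ α * (|z.1| ^ α / |(g z).1| ^ α) *
      Complex.normSq (conjDeriv hα g z) := by
  obtain ⟨hzs, -, hne⟩ := mem_regularSet.1 hz
  have e1 := (hasDerivAt_fst_fst hα hF hzs hne).deriv
  have e2 := (hasDerivAt_snd_fst hα hF hzs hne).deriv
  have e3 := (hasDerivAt_fst_snd hα hF hzs).deriv
  have e4 := (hasDerivAt_snd_snd hα hF hzs).deriv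
  rw [det_DH]
  simp only [X, Y, e1, e2, e3, e4, Complex.normSq_apply]
  ring

/-! ### Conformal maps preserve the singular line -/

/-- Makes the limits in condition (ii) unique. The line has dense complement, and an open image
under `g` must meet that complement too. -/
lemma source_subset_closure_regularSet (g : OpenPartialHomeomorph (ℝ × ℝ) (ℝ × ℝ)) :
    g.source ⊆ closure (regularSet g.source g) := by
  have hD : Dense {z : ℝ × ℝ | z.1 ≠ 0} := Measure.dense_of_ae ae_fst_ne_zero
  have hDo : IsOpen {z : ℝ × ℝ | z.1 ≠ 0} := isOpen_ne.preimage continuous_fst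
  intro z₀ hz₀
  rw [mem_closure_iff]
  intro o ho hzo
  have hW : IsOpen (o ∩ g.source ∩ {z : ℝ × ℝ | z.1 ≠ 0}) := (ho.inter g.open_source).inter hDo
  have hWs : o ∩ g.source ∩ {z : ℝ × ℝ | z.1 ≠ 0} ⊆ g.source := fun z hz => hz.1.2
  have hWn : (o ∩ g.source ∩ {z : ℝ × ℝ | z.1 ≠ 0}).Nonempty :=
    hD.inter_open_nonempty _ (ho.inter g.open_source) ⟨z₀, hzo, hz₀⟩
  obtain ⟨_, ⟨z, hz, rfl⟩, hgz⟩ := hD.inter_open_nonempty _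
    (g.isOpen_image_of_subset_source hW hWs) (hWn.image g)
  exact ⟨z, hz.1.1, mem_regularSet.2 ⟨hz.1.2, hz.2, hgz⟩⟩

/-- A conformal map preserves the singular line. -/
theorem IsSobolevConformal.fst_eq_zero_iff {α : ℝ} (hα : 0 < α)
    {g : OpenPartialHomeomorph (ℝ × ℝ) (ℝ × ℝ)} (hg : IsSobolevConformal α g) {z₀ : ℝ × ℝ}
    (hz₀ : z₀ ∈ g.source) : z₀.1 = 0 ↔ (g z₀).1 = 0 := by
  have hF := hg.differentiableOn_conjMap hα
  have hlim := hg.2.1.2.2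
  have hne : (𝓝[regularSet g.source g] z₀).NeBot :=
    mem_closure_iff_nhdsWithin_neBot.1 (source_subset_closure_regularSet g hz₀)
  have hRs : regularSet g.source g ⊆ g.source := fun z hz => (mem_regularSet.1 hz).1
  have hx : Tendsto (fun z : ℝ × ℝ => |z.1| ^ α) (𝓝[regularSet g.source g] z₀)
      (𝓝 (|z₀.1| ^ α)) :=
    (((continuous_abs_rpow hα).comp continuous_fst).tendsto z₀).mono_left inf_le_left
  have hg1 : Tendsto (fun z : ℝ × ℝ => |(g z).1| ^ α) (𝓝[regularSet g.source g] z₀)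
      (𝓝 (|(g z₀).1| ^ α)) := by
    have h1 : ContinuousAt (fun z => |(g z).1| ^ α) z₀ :=
      ((continuous_abs_rpow hα).comp continuous_fst).continuousAt.comp (g.continuousAt hz₀)
    exact h1.tendsto.mono_left inf_le_left
  have hD : Tendsto (conjDeriv hα g) (𝓝[regularSet g.source g] z₀) (𝓝 (conjDeriv hα g z₀)) :=
    ((continuousOn_conjDeriv hα hF) z₀ hz₀).tendsto.mono_left (nhdsWithin_mono _ hRs)
  constructor
  -- If `x = 0` but `g₁ ≠ 0`, the scalar factor of `Dα g` tends to 0, which forces `L = 0`.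
  · intro h0
    by_contra hcon
    obtain ⟨L, hL, hLlim⟩ := hlim z₀ ⟨hz₀, Or.inl h0⟩
    apply hL
    have hpos : |(g z₀).1| ^ α ≠ 0 := (Real.rpow_pos_of_pos (abs_pos.2 hcon) _).ne'
    have h1 := (hx.div hg1 hpos).smul ((continuous_mulMatrix.tendsto _).comp hD)
    have h2 : |z₀.1| ^ α = 0 := by rw [h0, abs_zero, Real.zero_rpow hα.ne']
    rw [h2, zero_div, zero_smul] at h1
    refine tendsto_nhds_unique hLlim (h1.congr' ?_)
    filter_upwards [self_mem_nhdsWithin] with z hz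
    exact (Dα_eq hα hF hz).symm
  -- If `g₁ = 0` but `x ≠ 0`, multiply by `|g₁|^α`: the finite limit yields `|x|^α F' = 0`, against
  -- `F' ≠ 0`.
  · intro h0
    by_contra hcon
    obtain ⟨L, hL, hLlim⟩ := hlim z₀ ⟨hz₀, Or.inr h0⟩
    have h1 := hg1.smul hLlim
    have h2 : |(g z₀).1| ^ α = 0 := by rw [h0, abs_zero, Real.zero_rpow hα.ne']
    rw [h2, zero_smul] at h1
    have h3 := hx.smul ((continuous_mulMatrix.tendsto _).comp hD)
    have h4 := tendsto_nhds_unique h1 (h3.congr' (by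
      filter_upwards [self_mem_nhdsWithin] with z hz
      have : |(g z).1| ^ α ≠ 0 :=
        (Real.rpow_pos_of_pos (abs_pos.2 (mem_regularSet.1 hz).2.2) _).ne'
      rw [Dα_eq hα hF hz, smul_smul, mul_div_cancel₀ _ this]
      rfl))
    have hpos : |z₀.1| ^ α ≠ 0 := (Real.rpow_pos_of_pos (abs_pos.2 hcon) _).ne'
    have h5 : mulMatrix (conjDeriv hα g z₀) = 0 := (smul_eq_zero.1 h4.symm).resolve_left hpos
    apply conjDeriv_ne_zero hα hF hz₀
    apply Complex.ext
    · exact congrFun (congrFun h5 0) 0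
    · exact congrFun (congrFun h5 1) 0

/-! ### Continuous partial derivatives and Sobolev membership -/

lemma hasDerivAt_of_eventually_hasDerivAt {f f' : ℝ → ℝ} {x : ℝ}
    (hd : ∀ᶠ y in 𝓝[≠] x, HasDerivAt f (f' y) y) (hf : ContinuousAt f x)
    (hf' : ContinuousAt f' x) : HasDerivAt f (f' x) x := by
  set s := {y | HasDerivAt f (f' y) y}
  have hds : DifferentiableOn ℝ f s := fun y hy => hy.differentiableAt.differentiableWithinAt
  have hlim {l : Filter ℝ} (hl : l ≤ 𝓝[≠] x) : Tendsto (fun y => deriv f y) l (𝓝 (f' x)) := by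
    refine (hf'.tendsto.mono_left (hl.trans inf_le_left)).congr' ?_
    filter_upwards [hl hd] with y hy using hy.deriv.symm
  have h1 : HasDerivWithinAt f (f' x) (Set.Ici x) x :=
    hasDerivWithinAt_Ici_of_tendsto_deriv hds hf.continuousWithinAt
      ((nhdsGT_le_nhdsNE x) hd) (hlim (nhdsGT_le_nhdsNE x))
  have h2 : HasDerivWithinAt f (f' x) (Set.Iic x) x :=
    hasDerivWithinAt_Iic_of_tendsto_deriv hds hf.continuousWithinAt
      ((nhdsLT_le_nhdsNE x) hd) (hlim (nhdsLT_le_nhdsNE x))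
  simpa using h2.union h1

lemma integrable_mul_of_tsupport_subset {U : Set (ℝ × ℝ)} {u φ : ℝ × ℝ → ℝ}
    (hu : ContinuousOn u U) (hφ : Continuous φ) {K : Set (ℝ × ℝ)} (hK : IsCompact K)
    (hKU : K ⊆ U) (h0 : ∀ z, z ∉ K → φ z = 0) : Integrable (fun z => u z * φ z) := by
  have h1 : IntegrableOn (fun z => u z * φ z) K :=
    ((hu.mono hKU).mul hφ.continuousOn).integrableOn_compact hK
  exact h1.integrable_of_forall_notMem_eq_zero fun z hz => by rw [h0 z hz, mul_zero]

/-- A continuous directional derivative is a weak derivative. -/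
lemma hasWeakDerivOn_of_hasLineDerivAt {U : Set (ℝ × ℝ)} (hU : IsOpen U) {e : ℝ × ℝ}
    {u v : ℝ × ℝ → ℝ} (hu : ContinuousOn u U) (hv : ContinuousOn v U)
    (h : ∀ z ∈ U, HasLineDerivAt ℝ u (v z) z e) : HasWeakDerivOn U e u v := by
  refine ⟨hu.locallyIntegrableOn hU.measurableSet, hv.locallyIntegrableOn hU.measurableSet,
    fun φ h1 h2 h3 => ?_⟩
  have hφ' : Continuous fun z => fderiv ℝ φ z e :=
    (h1.continuous_fderiv (by simp)).clm_apply continuous_const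
  have hz1 : ∀ z, z ∉ tsupport φ → fderiv ℝ φ z e = 0 := by
    intro z hz
    have : fderiv ℝ φ z = 0 := by
      by_contra h0
      exact hz (support_fderiv_subset ℝ h0)
    rw [this]
    rfl
  have hz2 : ∀ z, z ∉ tsupport φ → φ z = 0 := fun z hz => image_eq_zero_of_notMem_tsupport hz
  have key := integral_bilinear_hasLineDerivAt_right_eq_neg_left_of_integrable
    (μ := (volume : Measure (ℝ × ℝ))) (B := ContinuousLinearMap.mul ℝ ℝ) (f := u) (f' := v)
    (g := φ) (g' := fun z => fderiv ℝ φ z e) (v := e)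
    (integrable_mul_of_tsupport_subset hv h1.continuous h2 h3 hz2)
    (integrable_mul_of_tsupport_subset hu hφ' h2 h3 hz1)
    (integrable_mul_of_tsupport_subset hu h1.continuous h2 h3 hz2)
    (fun z hz => h z (h3 hz))
    (fun z _ => ((h1.differentiable (by simp)) z).hasFDerivAt.hasLineDerivAt e)
  simp only [ContinuousLinearMap.mul_apply'] at key
  rw [setIntegral_eq_integral_of_forall_compl_eq_zero, key,
    setIntegral_eq_integral_of_forall_compl_eq_zero]
  · intro z hz
    rw [hz2 z fun h0 => hz (h3 h0), mul_zero]
  · intro z hz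
    rw [hz1 z fun h0 => hz (h3 h0), mul_zero]

lemma memLp_of_continuousOn {Ω U : Set (ℝ × ℝ)} {u : ℝ × ℝ → ℝ} (hu : ContinuousOn u Ω)
    (hU : IsOpen U) (hc : IsCompact (closure U)) (hs : closure U ⊆ Ω) (p : ENNReal) :
    MemLp u p (volume.restrict U) := by
  obtain ⟨C, hC⟩ := hc.exists_bound_of_continuousOn (hu.mono hs)
  have : IsFiniteMeasure ((volume : Measure (ℝ × ℝ)).restrict U) :=
    ⟨by
      rw [Measure.restrict_apply_univ]
      exact (measure_mono subset_closure).trans_lt hc.measure_lt_top⟩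
  refine MemLp.of_bound ((hu.mono (subset_closure.trans hs)).aestronglyMeasurable
    hU.measurableSet) C ?_
  rw [ae_restrict_iff' hU.measurableSet]
  exact Eventually.of_forall fun z hz => hC z (subset_closure hz)

/-- Continuous functions are bounded on the compact closure of `U`, so every exponent `p` is covered
at once. -/
lemma memHW_of_hasDerivAt {α : ℝ} (hα : 0 < α) {Ω U : Set (ℝ × ℝ)} {u ux uy : ℝ × ℝ → ℝ}
    (hu : ContinuousOn u Ω) (hux : ContinuousOn ux Ω) (huy : ContinuousOn uy Ω)
    (hdx : ∀ z ∈ Ω, HasDerivAt (fun t => u (t, z.2)) (ux z) z.1)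
    (hdy : ∀ z ∈ Ω, HasDerivAt (fun t => u (z.1, t)) (uy z) z.2)
    (hU : IsOpen U) (hc : IsCompact (closure U)) (hs : closure U ⊆ Ω) (p : ENNReal) :
    MemHW α p U u := by
  have hUΩ : U ⊆ Ω := subset_closure.trans hs
  refine ⟨memLp_of_continuousOn hu hU hc hs p, ux, uy,
    hasWeakDerivOn_of_hasLineDerivAt hU (hu.mono hUΩ) (hux.mono hUΩ) fun z hz => ?_,
    hasWeakDerivOn_of_hasLineDerivAt hU (hu.mono hUΩ) (huy.mono hUΩ) fun z hz => ?_,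
    memLp_of_continuousOn hux hU hc hs p, memLp_of_continuousOn ?_ hU hc hs p⟩
  · have h1 : HasDerivAt (fun t => u (z.1 + t, z.2)) (ux z) 0 := by
      have := hdx z (hUΩ hz)
      rw [← add_zero z.1] at this
      simpa using this.comp_const_add z.1 0
    have h2 : ∀ t : ℝ, z + t • ((1 : ℝ), (0 : ℝ)) = (z.1 + t, z.2) := fun t => by ext <;> simp
    simpa only [HasLineDerivAt, h2] using h1
  · have h1 : HasDerivAt (fun t => u (z.1, z.2 + t)) (uy z) 0 := by
      have := hdy z (hUΩ hz)
      rw [← add_zero z.2] at this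
      simpa using this.comp_const_add z.2 0
    have h2 : ∀ t : ℝ, z + t • ((0 : ℝ), (1 : ℝ)) = (z.1, z.2 + t) := fun t => by ext <;> simp
    simpa only [HasLineDerivAt, h2] using h1
  · exact ((continuous_abs_rpow hα).comp continuous_fst).continuousOn.mul huy

/-! ### Holomorphic maps preserving the singular line are conformal -/

/-- In the coordinates `Phi`, the map `g` is holomorphic and preserves the singular line. -/
structure IsHolomorphic {α : ℝ} (hα : 0 < α) (g : OpenPartialHomeomorph (ℝ × ℝ) (ℝ × ℝ)) :
    Prop where
  differentiableOn : DifferentiableOn ℂ (conjMap hα g) (conjMap hα g).source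
  fst_eq_zero_iff : ∀ z ∈ g.source, z.1 = 0 ↔ (g z).1 = 0

lemma tendsto_zero_prod {z₀ : ℝ × ℝ} (h0 : z₀.1 = 0) :
    Tendsto (fun z : ℝ × ℝ => ((0 : ℝ), z.2)) (𝓝 z₀) (𝓝 z₀) := by
  apply Continuous.tendsto' (by fun_prop)
  exact Prod.ext h0.symm rfl

lemma Phi_sub_Phi_zero {α : ℝ} (hα : 0 < α) (z : ℝ × ℝ) :
    Phi hα z - Phi hα (0, z.2) = (phi α z.1 : ℂ) := by
  rw [Phi_eq, Phi_eq, phi_zero]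
  push_cast
  ring

namespace IsHolomorphic

variable {α : ℝ} {hα : 0 < α} {g : OpenPartialHomeomorph (ℝ × ℝ) (ℝ × ℝ)}

/-- Along the singular line `Re F` is identically 0, and its vertical derivative is `Re (i F') = -Im
F'`. -/
lemma im_conjDeriv_eq_zero (h : IsHolomorphic hα g) {z : ℝ × ℝ} (hz : z ∈ g.source)
    (h0 : z.1 = 0) : (conjDeriv hα g z).im = 0 := by
  have h1 := hasDerivAt_re (hasDerivAt_Phi_snd hα h.differentiableOn hz)
  simp only [Phi_re, Complex.I_mul_re] at h1
  have h2 : (fun t => phi α (g (z.1, t)).1) =ᶠ[𝓝 z.2] fun _ => 0 := by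
    have ht : Tendsto (fun t : ℝ => (z.1, t)) (𝓝 z.2) (𝓝 z) :=
      Continuous.tendsto' (by fun_prop) _ _ rfl
    filter_upwards [ht (g.open_source.mem_nhds hz)] with t ht'
    rw [(h.fst_eq_zero_iff _ ht').1 h0, phi_zero]
  have h3 := h1.unique ((hasDerivAt_const z.2 (0 : ℝ)).congr_of_eventuallyEq h2)
  linarith

lemma analyticAt (h : IsHolomorphic hα g) {z : ℝ × ℝ} (hz : z ∈ g.source) :
    AnalyticAt ℂ (conjMap hα g) (Phi hα z) :=
  h.differentiableOn.analyticAt ((conjMap hα g).open_source.mem_nhds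
    ((Phi_mem_conjMap_source hα).2 hz))

lemma tendsto_pair {z₀ : ℝ × ℝ} (h0 : z₀.1 = 0) :
    Tendsto (fun z : ℝ × ℝ => (Phi hα z, Phi hα (0, z.2))) (𝓝 z₀)
      (𝓝 (Phi hα z₀, Phi hα z₀)) :=
  ((Phi hα).continuous.tendsto z₀).prodMk_nhds
    (((Phi hα).continuous.tendsto z₀).comp (tendsto_zero_prod h0))

/-- Compare `z` with its projection `(0, z.2)`: the two `Phi` values differ by the real number `phi
z.1`, and `Re F` vanishes at the projection. Strict differentiability is needed because the
projection moves with `z`. -/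
lemma tendsto_phi_div_phi (h : IsHolomorphic hα g) {z₀ : ℝ × ℝ} (hz₀ : z₀ ∈ g.source)
    (h0 : z₀.1 = 0) : Tendsto (fun z => phi α (g z).1 / phi α z.1) (𝓝[{z | z.1 ≠ 0}] z₀)
      (𝓝 (conjDeriv hα g z₀).re) := by
  have hs := (h.analyticAt hz₀).hasStrictDerivAt
  have h1 := hs.isLittleO.comp_tendsto (tendsto_pair (hα := hα) h0)
  have h2 : (fun z : ℝ × ℝ => phi α (g z).1 - phi α z.1 * (conjDeriv hα g z₀).re) =o[𝓝 z₀]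
      fun z => phi α z.1 := by
    refine Asymptotics.IsLittleO.of_bound fun c hc => ?_
    have h3 := h1.def hc
    filter_upwards [h3, tendsto_zero_prod h0 (g.open_source.mem_nhds hz₀)] with z hz1 hz2
    have e1 : (g (0, z.2)).1 = 0 := (h.fst_eq_zero_iff _ hz2).1 rfl
    simp only [Function.comp, ContinuousLinearMap.toSpanSingleton_apply, conjMap_Phi,
      Phi_sub_Phi_zero, smul_eq_mul] at hz1
    rw [Complex.norm_real] at hz1
    refine le_trans ?_ hz1
    refine le_trans (le_of_eq ?_) (Complex.abs_re_le_norm _)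
    simp only [Complex.sub_re, Phi_re, e1, phi_zero, Complex.re_ofReal_mul, sub_zero]
    rfl
  have h3 := (h2.tendsto_div_nhds_zero.mono_left
    (inf_le_left : 𝓝[{z : ℝ × ℝ | z.1 ≠ 0}] z₀ ≤ 𝓝 z₀)).add_const (conjDeriv hα g z₀).re
  rw [zero_add] at h3
  refine h3.congr' ?_
  filter_upwards [self_mem_nhdsWithin] with z hz
  have : phi α z.1 ≠ 0 := (phi_eq_zero hα).not.2 hz
  field_simp
  ring

open Classical in
/-- The absolute difference quotient across the singular line, extended by the absolute derivative
to the line. -/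
noncomputable def ratio (hα : 0 < α) (g : OpenPartialHomeomorph (ℝ × ℝ) (ℝ × ℝ)) (z : ℝ × ℝ) : ℝ :=
  if z.1 = 0 then ‖conjDeriv hα g z‖ else |phi α (g z).1 / phi α z.1|

lemma ratio_pos (h : IsHolomorphic hα g) {z : ℝ × ℝ} (hz : z ∈ g.source) :
    0 < ratio hα g z := by
  rw [ratio]
  split_ifs with h0
  · exact norm_pos_iff.2 (conjDeriv_ne_zero hα h.differentiableOn hz)
  · refine abs_pos.2 (div_ne_zero ?_ ((phi_eq_zero hα).not.2 h0))
    exact (phi_eq_zero hα).not.2 ((h.fst_eq_zero_iff z hz).not.1 h0)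

lemma continuousAt_fst (_h : IsHolomorphic hα g) {z : ℝ × ℝ} (hz : z ∈ g.source) :
    ContinuousAt (fun z => (g z).1) z :=
  continuous_fst.continuousAt.comp (g.continuousAt hz)

lemma continuousAt_conjDeriv (h : IsHolomorphic hα g) {z : ℝ × ℝ} (hz : z ∈ g.source) :
    ContinuousAt (conjDeriv hα g) z :=
  (continuousOn_conjDeriv hα h.differentiableOn).continuousAt (g.open_source.mem_nhds hz)

lemma continuousAt_ratio (h : IsHolomorphic hα g) {z₀ : ℝ × ℝ} (hz₀ : z₀ ∈ g.source) :
    ContinuousAt (ratio hα g) z₀ := by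
  by_cases h0 : z₀.1 = 0
  · have hval : ratio hα g z₀ = ‖conjDeriv hα g z₀‖ := by rw [ratio, if_pos h0]
    rw [ContinuousAt, hval]
    apply Tendsto.if
    · exact (h.continuousAt_conjDeriv hz₀).norm.tendsto.mono_left inf_le_left
    · have h1 := (h.tendsto_phi_div_phi hz₀ h0).abs
      have h2 : |(conjDeriv hα g z₀).re| = ‖conjDeriv hα g z₀‖ :=
        Complex.abs_re_eq_norm.2 (h.im_conjDeriv_eq_zero hz₀ h0)
      rw [h2] at h1
      exact h1
  · have h1 : ContinuousAt (fun z => |phi α (g z).1 / phi α z.1|) z₀ := by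
      refine ContinuousAt.abs (ContinuousAt.div ?_ ?_ ((phi_eq_zero hα).not.2 h0))
      · exact (continuous_phi hα).continuousAt.comp (h.continuousAt_fst hz₀)
      · exact ((continuous_phi hα).comp continuous_fst).continuousAt
    refine h1.congr ?_
    have ho : IsOpen {z : ℝ × ℝ | z.1 ≠ 0} := isOpen_ne.preimage continuous_fst
    filter_upwards [ho.mem_nhds h0] with z hz
    rw [ratio, if_neg hz]

/-- The conformal factor `|x|^α / |g₁|^α`, extended continuously to the singular line. -/
noncomputable def kappa (hα : 0 < α) (g : OpenPartialHomeomorph (ℝ × ℝ) (ℝ × ℝ)) (z : ℝ × ℝ) : ℝ :=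
  ratio hα g z ^ (-(α / (α + 1)))

lemma kappa_pos (h : IsHolomorphic hα g) {z : ℝ × ℝ} (hz : z ∈ g.source) :
    0 < kappa hα g z := Real.rpow_pos_of_pos (h.ratio_pos hz) _

lemma continuousAt_kappa (h : IsHolomorphic hα g) {z : ℝ × ℝ} (hz : z ∈ g.source) :
    ContinuousAt (kappa hα g) z :=
  (h.continuousAt_ratio hz).rpow_const (Or.inl (h.ratio_pos hz).ne')

/-- Since `|phi x|` is proportional to `|x|^(α+1)`, the ratio is `(|g₁|/|x|)^(α+1)`; this dictates
the exponent `-α/(α+1)` in `kappa`. -/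
lemma kappa_eq (h : IsHolomorphic hα g) {z : ℝ × ℝ} (hz : z ∈ g.source) (h0 : z.1 ≠ 0) :
    kappa hα g z = |z.1| ^ α / |(g z).1| ^ α := by
  have hα1 : 0 < α + 1 := by linarith
  have hx : 0 < |z.1| := abs_pos.2 h0
  have hg : 0 < |(g z).1| := abs_pos.2 ((h.fst_eq_zero_iff z hz).not.1 h0)
  have h1 : ratio hα g z = (|(g z).1| / |z.1|) ^ (α + 1) := by
    rw [ratio, if_neg h0, abs_div, abs_phi hα, abs_phi hα, Real.div_rpow hg.le hx.le]
    field_simp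
  rw [kappa, h1, ← Real.rpow_mul (by positivity)]
  have h2 : (α + 1) * -(α / (α + 1)) = -α := by field_simp
  rw [h2, Real.rpow_neg (by positivity), ← Real.inv_rpow (by positivity), inv_div,
    Real.div_rpow hx.le hg.le]

/-- On the singular line `phi` has zero derivative and cannot be inverted differentiably; the
formula is extended there by continuity of the derivative. -/
lemma hasDerivAt_fst_fst (h : IsHolomorphic hα g) {z : ℝ × ℝ} (hz : z ∈ g.source) :
    HasDerivAt (fun t => (g (t, z.2)).1) (kappa hα g z * (conjDeriv hα g z).re) z.1 := by
  by_cases h0 : z.1 = 0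
  · have ht : ContinuousAt (fun t : ℝ => (t, z.2)) z.1 := by fun_prop
    have hc {k : ℝ × ℝ → ℝ} (hk : ContinuousAt k z) : ContinuousAt (fun t => k (t, z.2)) z.1 :=
      ContinuousAt.comp_of_eq hk ht rfl
    refine hasDerivAt_of_eventually_hasDerivAt
      (f' := fun t => kappa hα g (t, z.2) * (conjDeriv hα g (t, z.2)).re) ?_
      (hc (h.continuousAt_fst hz))
      (hc (k := fun z => kappa hα g z * (conjDeriv hα g z).re) ?_)
    · filter_upwards [self_mem_nhdsWithin, mem_nhdsWithin_of_mem_nhds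
        (ht (g.open_source.mem_nhds hz))] with t ht1 ht2
      have ht1' : t ≠ 0 := h0 ▸ ht1
      have h1 := Grushin.hasDerivAt_fst_fst hα h.differentiableOn (z := (t, z.2)) ht2
        ((h.fst_eq_zero_iff _ ht2).not.1 ht1')
      rwa [← h.kappa_eq ht2 ht1'] at h1
    · exact (h.continuousAt_kappa hz).mul
        (Complex.continuous_re.continuousAt.comp (h.continuousAt_conjDeriv hz))
  · have h1 := Grushin.hasDerivAt_fst_fst hα h.differentiableOn hz
      ((h.fst_eq_zero_iff z hz).not.1 h0)
    rwa [← h.kappa_eq hz h0] at h1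

lemma hasDerivAt_snd_fst (h : IsHolomorphic hα g) {z : ℝ × ℝ} (hz : z ∈ g.source) :
    HasDerivAt (fun t => (g (z.1, t)).1) (-(conjDeriv hα g z).im / |(g z).1| ^ α) z.2 := by
  by_cases h0 : z.1 = 0
  -- The denominator is 0 here, but the numerator is 0 too; the resulting value 0 is the true
  -- derivative, as `g₁` vanishes along the line.
  · rw [h.im_conjDeriv_eq_zero hz h0, neg_zero, zero_div]
    refine (hasDerivAt_const z.2 (0 : ℝ)).congr_of_eventuallyEq ?_
    have ht : Tendsto (fun t : ℝ => (z.1, t)) (𝓝 z.2) (𝓝 z) :=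
      Continuous.tendsto' (by fun_prop) _ _ rfl
    filter_upwards [ht (g.open_source.mem_nhds hz)] with t ht'
    exact (h.fst_eq_zero_iff _ ht').1 h0
  · exact Grushin.hasDerivAt_snd_fst hα h.differentiableOn hz
      ((h.fst_eq_zero_iff z hz).not.1 h0)

/-- `F'` is locally Lipschitz, and its imaginary part vanishes at the projection `(0, z.2)`, at
distance `|phi z.1|` in `ℂ`. -/
lemma isBigO_im_conjDeriv (h : IsHolomorphic hα g) {z₀ : ℝ × ℝ} (hz₀ : z₀ ∈ g.source)
    (h0 : z₀.1 = 0) :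
    (fun z => (conjDeriv hα g z).im) =O[𝓝 z₀] fun z : ℝ × ℝ => phi α z.1 := by
  have hs := (h.analyticAt hz₀).deriv.hasStrictDerivAt
  have h1 := hs.hasStrictFDerivAt.isBigO_sub.comp_tendsto (tendsto_pair (hα := hα) h0)
  obtain ⟨C, hC⟩ := h1.bound
  refine Asymptotics.IsBigO.of_bound C ?_
  filter_upwards [hC, tendsto_zero_prod h0 (g.open_source.mem_nhds hz₀)] with z hz1 hz2
  have e1 : (conjDeriv hα g (0, z.2)).im = 0 := h.im_conjDeriv_eq_zero hz2 rfl
  simp only [Function.comp, Phi_sub_Phi_zero, Complex.norm_real] at hz1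
  refine le_trans (le_trans (le_of_eq ?_) (Complex.abs_im_le_norm _)) hz1
  have e2 : (deriv (conjMap hα g) (Phi hα (0, z.2))).im = 0 := e1
  rw [Complex.sub_im, e2, sub_zero]
  rfl

/-- Near the line the numerator is `O(|x|^(α+1))` while `|g₁|^α` is comparable to `|x|^α`, so the
quotient is bounded by `C · kappa · |x| / (α+1)` and tends to 0. -/
lemma continuousAt_partialY (h : IsHolomorphic hα g) {z₀ : ℝ × ℝ} (hz₀ : z₀ ∈ g.source) :
    ContinuousAt (fun z => -(conjDeriv hα g z).im / |(g z).1| ^ α) z₀ := by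
  by_cases h0 : z₀.1 = 0
  · rw [ContinuousAt, h.im_conjDeriv_eq_zero hz₀ h0, neg_zero, zero_div]
    obtain ⟨C, hC⟩ := (h.isBigO_im_conjDeriv hz₀ h0).bound
    have hlim : Tendsto (fun z : ℝ × ℝ => C * (kappa hα g z * |z.1| / (α + 1))) (𝓝 z₀) (𝓝 0) := by
      have h1 : ContinuousAt (fun z : ℝ × ℝ => C * (kappa hα g z * |z.1| / (α + 1))) z₀ :=
        (((h.continuousAt_kappa hz₀).mul (continuous_abs.comp continuous_fst).continuousAt
          ).div_const _).const_mul C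
      have h2 := h1.tendsto
      simpa [h0] using h2
    refine squeeze_zero_norm' ?_ hlim
    filter_upwards [hC, g.open_source.mem_nhds hz₀] with z hz1 hz2
    by_cases hz0 : z.1 = 0
    · rw [h.im_conjDeriv_eq_zero hz2 hz0, hz0]
      simp
    · have hg : 0 < |(g z).1| ^ α :=
        Real.rpow_pos_of_pos (abs_pos.2 ((h.fst_eq_zero_iff z hz2).not.1 hz0)) _
      rw [norm_div, norm_neg, h.kappa_eq hz2 hz0, Real.norm_of_nonneg hg.le, div_le_iff₀ hg]
      refine hz1.trans (le_of_eq ?_)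
      rw [Real.norm_eq_abs, abs_phi hα, Real.rpow_add_one (abs_pos.2 hz0).ne']
      field_simp
  · have hne := (h.fst_eq_zero_iff z₀ hz₀).not.1 h0
    refine ContinuousAt.div ?_ ?_ (Real.rpow_pos_of_pos (abs_pos.2 hne) _).ne'
    · exact (Complex.continuous_im.continuousAt.comp (h.continuousAt_conjDeriv hz₀)).neg
    · exact (continuous_abs_rpow hα).continuousAt.comp (h.continuousAt_fst hz₀)

lemma memHWLocMap (h : IsHolomorphic hα g) (p : ENNReal) :
    MemHWLocMap α p g.source g.target g := by
  refine ⟨g.mapsTo, fun U hU hc hs => ⟨g.mapsTo.mono_left (subset_closure.trans hs), ?_, ?_⟩⟩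
  · exact memHW_of_hasDerivAt hα (continuous_fst.comp_continuousOn g.continuousOn)
      (ux := fun z => kappa hα g z * (conjDeriv hα g z).re)
      (uy := fun z => -(conjDeriv hα g z).im / |(g z).1| ^ α)
      (fun z hz => ((h.continuousAt_kappa hz).mul (Complex.continuous_re.continuousAt.comp
        (h.continuousAt_conjDeriv hz))).continuousWithinAt)
      (fun z hz => (h.continuousAt_partialY hz).continuousWithinAt)
      (fun z hz => h.hasDerivAt_fst_fst hz) (fun z hz => h.hasDerivAt_snd_fst hz) hU hc hs p
  · exact memHW_of_hasDerivAt hα (continuous_snd.comp_continuousOn g.continuousOn)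
      (ux := fun z => |z.1| ^ α * (conjDeriv hα g z).im)
      (uy := fun z => (conjDeriv hα g z).re)
      (((continuous_abs_rpow hα).comp continuous_fst).continuousOn.mul
        (Complex.continuous_im.comp_continuousOn (continuousOn_conjDeriv hα h.differentiableOn)))
      (Complex.continuous_re.comp_continuousOn (continuousOn_conjDeriv hα h.differentiableOn))
      (fun z hz => hasDerivAt_fst_snd hα h.differentiableOn hz)
      (fun z hz => hasDerivAt_snd_snd hα h.differentiableOn hz) hU hc hs p

/-- A map that is holomorphic in the coordinates `Phi` and preserves the singular line is
conformal. -/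
theorem isSobolevConformal (h : IsHolomorphic hα g) : IsSobolevConformal α g := by
  have hRs : regularSet g.source g ⊆ g.source := fun z hz => (mem_regularSet.1 hz).1
  refine ⟨⟨h.memHWLocMap 1, ?_⟩, ⟨h.memHWLocMap 2, ?_, ?_⟩, h.memHWLocMap _⟩
  · rw [ae_restrict_iff' g.open_source.measurableSet]
    filter_upwards [ae_fst_ne_zero] with z h0 hz
    have hne := (h.fst_eq_zero_iff z hz).not.1 h0
    rw [det_DH_eq hα h.differentiableOn (mem_regularSet.2 ⟨hz, h0, hne⟩)]
    have h1 := Real.rpow_pos_of_pos (abs_pos.2 h0) α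
    have h2 := Real.rpow_pos_of_pos (abs_pos.2 hne) α
    have h3 := Complex.normSq_pos.2 (conjDeriv_ne_zero hα h.differentiableOn hz)
    positivity
  · rw [ae_restrict_iff' (isOpen_regularSet g).measurableSet]
    refine Eventually.of_forall fun z hz => ?_
    obtain ⟨hzs, h0, hne⟩ := mem_regularSet.1 hz
    have h3 := conjDeriv_ne_zero hα h.differentiableOn hzs
    set w := conjDeriv hα g z with hw
    have hn : 0 < ‖w‖ := norm_pos_iff.2 h3
    -- Multiplication by `w` is `‖w‖` times a rotation.
    refine ⟨kappa hα g z * ‖w‖, mul_pos (h.kappa_pos hzs) hn, ‖w‖⁻¹ • mulMatrix w, ?_, ?_⟩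
    · rw [Matrix.mem_orthogonalGroup_iff]
      have hsq : w.re * w.re + w.im * w.im = ‖w‖ ^ 2 := by
        rw [Complex.sq_norm, Complex.normSq_apply]
      ext i j
      fin_cases i <;> fin_cases j <;>
        simp [mulMatrix, Matrix.mul_apply, Fin.sum_univ_two] <;> field_simp <;> linarith
    · rw [Dα_eq hα h.differentiableOn hz, ← h.kappa_eq hzs h0, smul_smul, mul_assoc,
        mul_inv_cancel₀ hn.ne', mul_one]
  · rintro z₀ ⟨hz₀, -⟩
    refine ⟨kappa hα g z₀ • mulMatrix (conjDeriv hα g z₀), ?_, ?_⟩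
    · intro hcon
      have h5 := (smul_eq_zero.1 hcon).resolve_left (h.kappa_pos hz₀).ne'
      apply conjDeriv_ne_zero hα h.differentiableOn hz₀
      apply Complex.ext
      · exact congrFun (congrFun h5 0) 0
      · exact congrFun (congrFun h5 1) 0
    · have h1 : ContinuousAt (fun z => kappa hα g z • mulMatrix (conjDeriv hα g z)) z₀ :=
        (h.continuousAt_kappa hz₀).smul
          (continuous_mulMatrix.continuousAt.comp (h.continuousAt_conjDeriv hz₀))
      refine (h1.tendsto.mono_left inf_le_left).congr' ?_
      filter_upwards [self_mem_nhdsWithin] with z hz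
      obtain ⟨hzs, h0, -⟩ := mem_regularSet.1 hz
      rw [Dα_eq hα h.differentiableOn hz, h.kappa_eq hzs h0]

end IsHolomorphic

/-- A map belongs to the class of conformal maps if and only if it is holomorphic in the
coordinates `Phi` and preserves the singular line. -/
theorem isSobolevConformal_iff {α : ℝ} (hα : 0 < α)
    {g : OpenPartialHomeomorph (ℝ × ℝ) (ℝ × ℝ)} :
    IsSobolevConformal α g ↔ IsHolomorphic hα g :=
  ⟨fun h => ⟨h.differentiableOn_conjMap hα, fun _ hz => h.fst_eq_zero_iff hα hz⟩,
    fun h => h.isSobolevConformal⟩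

/-! ### Composition, inversion and dilations -/

namespace IsHolomorphic

variable {α : ℝ} {hα : 0 < α} {g h : OpenPartialHomeomorph (ℝ × ℝ) (ℝ × ℝ)}

lemma symm (hg : IsHolomorphic hα g) : IsHolomorphic hα g.symm := by
  refine ⟨differentiableOn_symm _ hg.differentiableOn, fun z hz => ?_⟩
  have h1 := hg.fst_eq_zero_iff (g.symm z) (g.map_target hz)
  rw [g.right_inv hz] at h1
  exact h1.symm

lemma trans (hg : IsHolomorphic hα g) (hh : IsHolomorphic hα h) :
    IsHolomorphic hα (g.trans h) := by
  refine ⟨?_, fun z hz => ?_⟩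
  · have h1 : DifferentiableOn ℂ (conjMap hα h ∘ conjMap hα g)
        (conjMap hα (g.trans h)).source := by
      refine hh.differentiableOn.comp (hg.differentiableOn.mono fun w hw => hw.1) fun w hw => ?_
      rw [conjMap_apply, Phi_mem_conjMap_source]
      exact hw.2
    refine h1.congr fun w _ => ?_
    simp [conjMap_apply]
  · rw [hg.fst_eq_zero_iff z hz.1, hh.fst_eq_zero_iff (g z) hz.2]
    rfl

end IsHolomorphic

/-- `phi` is homogeneous of degree `α + 1`, so both coordinates scale by `r^(α+1)` and the
conjugated map is complex linear. -/
lemma isHolomorphic_dilation {α : ℝ} (hα : 0 < α) {r : ℝ} (hr : 0 < r) :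
    IsHolomorphic hα (dilation α r hr).toOpenPartialHomeomorph := by
  have hpow : r ^ (α + 1) = r * r ^ α := by rw [Real.rpow_add_one hr.ne', mul_comm]
  refine ⟨?_, fun z _ => ?_⟩
  · have h1 : ∀ w, conjMap hα (dilation α r hr).toOpenPartialHomeomorph w =
        ((r ^ (α + 1) : ℝ) : ℂ) * w := by
      intro w
      obtain ⟨z, rfl⟩ := (Phi hα).surjective w
      rw [conjMap_Phi]
      apply Complex.ext
      · rw [Complex.re_ofReal_mul, Phi_re, Phi_re]
        change phi α (r * z.1) = _
        rw [phi, phi, abs_mul, abs_of_pos hr, Real.mul_rpow hr.le (abs_nonneg _), hpow]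
        ring
      · rw [Complex.im_ofReal_mul, Phi_im, Phi_im]
        rfl
    have h2 : DifferentiableOn ℂ (fun w : ℂ => ((r ^ (α + 1) : ℝ) : ℂ) * w)
        (conjMap hα (dilation α r hr).toOpenPartialHomeomorph).source := by fun_prop
    exact h2.congr fun w _ => h1 w
  · change z.1 = 0 ↔ r * z.1 = 0
    simp [hr.ne']

end Grushin

theorem mainTheorem3 (α : ℝ) (hα : 0 < α)
    (g h : OpenPartialHomeomorph (ℝ × ℝ) (ℝ × ℝ))
    (hg : Grushin.IsSobolevConformal α g) (hh : Grushin.IsSobolevConformal α h) :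
    -- `h.trans g` is `g ∘ h` on `{z ∈ h.source | h z ∈ g.source}`
    (Grushin.IsSobolevConformal α (h.trans g) ∧ Grushin.IsSobolevConformal α (g.trans h)) ∧
    (Grushin.IsSobolevConformal α g.symm ∧ Grushin.IsSobolevConformal α h.symm) ∧
    ∀ (r : ℝ) (hr : 0 < r),
      Grushin.IsSobolevConformal α
        ((Grushin.dilation α r hr).toOpenPartialHomeomorph.trans g) ∧
      Grushin.IsSobolevConformal α
        (g.trans (Grushin.dilation α r hr).toOpenPartialHomeomorph) := by
  have hg' := (Grushin.isSobolevConformal_iff hα).1 hg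
  have hh' := (Grushin.isSobolevConformal_iff hα).1 hh
  refine ⟨⟨(hh'.trans hg').isSobolevConformal, (hg'.trans hh').isSobolevConformal⟩,
    ⟨hg'.symm.isSobolevConformal, hh'.symm.isSobolevConformal⟩, fun r hr => ⟨?_, ?_⟩⟩
  · exact ((Grushin.isHolomorphic_dilation hα hr).trans hg').isSobolevConformal
  · exact (hg'.trans (Grushin.isHolomorphic_dilation hα hr)).isSobolevConformal
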